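/- Let $n\ge 2$. Equip $\mathbf R^{n+1}$ with $B(x,x)=x_1^2-x_2^2-\dots-x_{n+1}^2$, let $\mathbf H^n=\{x: B(x,x)=1,\ x_1>0\}$, let $\mathrm{Isom}(\mathbf H^n)$ be the group of linear automorphisms of $\mathbf R^{n+1}$ which preserve $B$ and $\mathbf H^n$, and let $\mathrm O(n)$ be the stabilizer in it of $o=(1,0,\dots,0)$. Identify the set $\partial\mathbf H^n$ of $B$-isotropic lines with the unit sphere $\mathbf S^{n-1}\subset\mathbf R^n$ via $b\leftrightarrow\mathbf R(1,b)$, and let $\mathrm{Vol}$ be the rotation invariant probability measure on it. For $g\in\mathrm{Isom}(\mathbf H^n)$ put $|\mathrm{Jac}(g)|=d(g^{-1})_*\mathrm{Vol}/d\mathrm{Vol}$. For $t\in(0,1)$ let $s=\frac12+\frac t{n-1}$, and for $f\in L^2(\partial\mathbf H^n,\mathbf R)$ let $\pi_s(g)f=|\mathrm{Jac}(g^{-1})|^{\frac12+s}\, f\circ g^{-1}$. Let $L_s$ be the operator on $L^2(\partial\mathbf H^n,\mathbf R)$ intertwining $\pi_s$ and $\pi_{-s}$ given as follows. Extend $f$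 to the function $\Phi_f$ on the future light cone which is homogeneous of degree $-(\frac12+s)(n-1)$ and satisfies $\Phi_f\big(\tfrac1{\sqrt2}(1,b)\big)=f(b)$. Then $$L_sf(b)=c_s^{-1}\int_{v\in b^\perp}\Phi_f\Big(\tfrac{|v|^2}{2}\cdot\tfrac{1}{\sqrt2}(1,b)+\tfrac1{\sqrt2}(1,-b)+(0,v)\Big)\,dv ,$$ where $b^\perp\simeq\mathbf R^{n-1}$ is the orthogonal complement of $b$ in $\mathbf R^n$, and the constant $c_s>0$ is chosen so that $L_s1=1$. Let $\langle f,h\rangle_s=\int f\cdot L_sh\,d\mathrm{Vol}$. Let $H^0$ be the space of constant functions and let $V$ be the completion of the space of mean-zero functions in $L^2(\partial\mathbf H^n,\mathbf R)$ with respect to the inner product $-\langle\cdot,\cdot\rangle_s$. Then $L^2(\partial\mathbf H^n,\mathbf R)\subset H^0\oplus V$ and $\langle\cdot,\cdot\rangle_s$ extends to $H^0\oplus V$. Let $\mathbf H^\infty_t=\{x\in H^0\oplus V:\langle x,x\rangle_s=1,\ \langle x,1\rangle_s>0\}$, with the distance given by $\cosh d(x,y)=\langle x,y\rangle_s$, and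 let $\ast\in\mathbf H^\infty_t$ be the constant function $1$. Fix any $g\in\mathrm{Isom}(\mathbf H^n)$. For every $t\in(0,1)$ the function $\pi_s(g)(\ast)=|\mathrm{Jac}(g^{-1})|^{\frac12+s}$ is square integrable and is a point of $\mathbf H^\infty_t$. As $t\in(0,1)$ converges to $0$, the ratio $$\frac{d(\pi_s(g)(\ast),\ast)}{\sqrt t}$$ remains bounded; and it remains bounded away from zero if and only if $g\notin\mathrm O(n)$. -/

import Mathlib

open MeasureTheory Set
open scoped RealInnerProductSpace ENNReal

namespace HypRenorm

noncomputable section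

/-- Euclidean space `ℝⁿ`. -/
abbrev Euc (n : ℕ) : Type := EuclideanSpace ℝ (Fin n)

/-- `ℝⁿ⁺¹ = ℝ × ℝⁿ`; the first factor carries the coordinate `x₁`. -/
abbrev Mink (n : ℕ) : Type := ℝ × Euc n

/-- The Lorentz form `B(x, y) = x₁ y₁ - x₂ y₂ - ⋯ - xₙ₊₁ yₙ₊₁`. -/
def lor {n : ℕ} (x y : Mink n) : ℝ := x.1 * y.1 - ⟪x.2, y.2⟫

/-- The hyperboloid model of `Hⁿ`. -/
def hypSpace (n : ℕ) : Set (Mink n) := {x | lor x x = 1 ∧ 0 < x.1}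

/-- `Isom(Hⁿ)`: the linear automorphisms of `ℝⁿ⁺¹` which preserve `B` and map `Hⁿ` onto itself. -/
def hypIsom (n : ℕ) : Subgroup (Mink n ≃ₗ[ℝ] Mink n) where
  carrier := {g | (∀ x y, lor (g x) (g y) = lor x y) ∧ g '' hypSpace n = hypSpace n}
  mul_mem' := by
    rintro g h ⟨hg, hg'⟩ ⟨hh, hh'⟩
    refine ⟨fun x y => by rw [LinearEquiv.mul_apply, LinearEquiv.mul_apply, hg, hh], ?_⟩
    have : (⇑(g * h) : Mink n → Mink n) = g ∘ h := rfl
    rw [this, image_comp, hh', hg']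
  one_mem' := ⟨fun _ _ => rfl, by
    have : (⇑(1 : Mink n ≃ₗ[ℝ] Mink n) : Mink n → Mink n) = id := rfl
    rw [this, image_id]⟩
  inv_mem' := by
    rintro g ⟨hg, hg'⟩
    have h1 : ∀ x, g (g⁻¹ x) = x := fun x => g.apply_symm_apply x
    have h2 : ∀ x, g⁻¹ (g x) = x := fun x => g.symm_apply_apply x
    refine ⟨fun x y => by rw [← hg, h1, h1], ?_⟩
    conv_lhs => rw [← hg', image_image]
    simp [h2]

/-- The base point `o = (1, 0, …, 0)` of `Hⁿ`. -/
def origin (n : ℕ) : Mink n := (1, 0)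

/-- The maximal compact subgroup `K = O(n)`: the stabilizer of `o` in `Isom(Hⁿ)`. -/
def orthoGroup (n : ℕ) : Subgroup (hypIsom n) where
  carrier := {g | g.1 (origin n) = origin n}
  mul_mem' := by
    rintro g h hg hh
    change g.1 (h.1 (origin n)) = origin n
    rw [show h.1 (origin n) = origin n from hh, show g.1 (origin n) = origin n from hg]
  one_mem' := rfl
  inv_mem' := by
    rintro g hg
    change g.1.symm (origin n) = origin n
    rw [LinearEquiv.symm_apply_eq]
    exact (show g.1 (origin n) = origin n from hg).symm

/-- The boundary `∂Hⁿ`, identified with the unit sphere `Sⁿ⁻¹` of `ℝⁿ` (Klein model): the point `b`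
of the sphere stands for the isotropic line spanned by `(1, b)`. -/
abbrev Bdry (n : ℕ) : Type := Metric.sphere (0 : Euc n) 1

/-- The nonzero isotropic vectors of `ℝⁿ⁺¹`. -/
abbrev LightCone (n : ℕ) : Type := {p : Mink n // lor p p = 0 ∧ p ≠ 0}

theorem LightCone.sq_eq {n : ℕ} (p : LightCone n) : p.1.1 ^ 2 = ‖p.1.2‖ ^ 2 := by
  have h := p.2.1
  rw [lor, real_inner_self_eq_norm_sq] at h
  linarith

theorem LightCone.fst_ne_zero {n : ℕ} (p : LightCone n) : p.1.1 ≠ 0 := by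
  intro h
  have h2 := p.sq_eq
  rw [h] at h2
  have h3 : ‖p.1.2‖ = 0 := by nlinarith [norm_nonneg p.1.2]
  exact p.2.2 (Prod.ext h (norm_eq_zero.1 h3))

/-- The boundary point represented by a nonzero isotropic vector. -/
def LightCone.dir {n : ℕ} (p : LightCone n) : Bdry n :=
  ⟨p.1.1⁻¹ • p.1.2, by
    rw [mem_sphere_zero_iff_norm, norm_smul, norm_inv, Real.norm_eq_abs,
      (sq_eq_sq₀ (abs_nonneg _) (norm_nonneg _)).1 ((sq_abs _).trans p.sq_eq)]
    refine inv_mul_cancel₀ fun h => p.fst_ne_zero ?_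
    have h2 := p.sq_eq
    rw [h] at h2
    exact pow_eq_zero_iff two_ne_zero |>.1 (by simpa using h2)⟩

/-- The isotropic vector `(1, b)` attached to `b ∈ ∂Hⁿ`. -/
def rep {n : ℕ} (b : Bdry n) : LightCone n :=
  ⟨(1, b.1), by simp [lor, mem_sphere_zero_iff_norm.1 b.2],
    fun h => one_ne_zero (congrArg Prod.fst h)⟩

/-- The action of `Isom(Hⁿ)` on isotropic vectors. -/
def coneAct {n : ℕ} (g : hypIsom n) (p : LightCone n) : LightCone n :=
  ⟨g.1 p.1, by rw [g.2.1]; exact p.2.1, by simpa using p.2.2⟩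

/-- The action of `Isom(Hⁿ)` on `∂Hⁿ`. -/
def bdryAct {n : ℕ} (g : hypIsom n) (b : Bdry n) : Bdry n := (coneAct g (rep b)).dir

/-- The normalized rotation invariant volume of `∂Hⁿ`. -/
def bvol (n : ℕ) : Measure (Bdry n) :=
  ((volume : Measure (Euc n)).toSphere univ)⁻¹ • (volume : Measure (Euc n)).toSphere

/-- The Jacobian `|Jac(g)| = d(g⁻¹)_* Vol / d Vol`. -/
def jac {n : ℕ} (g : hypIsom n) (b : Bdry n) : ℝ :=
  (((bvol n).map (bdryAct g⁻¹)).rnDeriv (bvol n) b).toReal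

/-- The spherical principal series `π_s(g) f = |Jac(g⁻¹)|^(1/2 + s) · f ∘ g⁻¹`. -/
def prinSeries {n : ℕ} (s : ℝ) (g : hypIsom n) (f : Bdry n → ℝ) (b : Bdry n) : ℝ :=
  jac g⁻¹ b ^ (1 / 2 + s) * f (bdryAct g⁻¹ b)

/-- The isotropic vector `½|v|² ξ₁ + ξ₂ + v`, where `ξ₁ = (1, b)/√2`, `ξ₂ = (1, -b)/√2` and
`v ⟂ b`. For `k ∈ O(n)` with `k e₁ = b` these are the vectors `k g_{1,v,Id} σ ξ₁` of the standard
basis `ξ₁ = (1, e₁)/√2`, `ξ₂ = (1, -e₁)/√2`, where `g_{1,v,Id}` runs over the unipotent radical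
`≃ ℝⁿ⁻¹` of the stabilizer of the line `ℝ ξ₁`, and `σ` exchanges `ξ₁` and `ξ₂`. -/
def horo {n : ℕ} (b : Bdry n) (v : (ℝ ∙ (b : Euc n))ᗮ) : LightCone n :=
  ⟨(‖v‖ ^ 2 / 2) • ((1 / √2) • ((1, b.1) : Mink n)) + (1 / √2) • ((1, -b.1) : Mink n)
      + ((0, v.1) : Mink n), by
    have hb : ⟪b.1, b.1⟫ = 1 := by
      rw [real_inner_self_eq_norm_sq, mem_sphere_zero_iff_norm.1 b.2, one_pow]
    have hv : ⟪b.1, v.1⟫ = 0 := (Submodule.mem_orthogonal_singleton_iff_inner_right).1 v.2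
    have hv' : ⟪v.1, b.1⟫ = 0 := by rw [real_inner_comm, hv]
    have hvv : ⟪v.1, v.1⟫ = ‖v‖ ^ 2 := real_inner_self_eq_norm_sq _
    have h2 : (√2)⁻¹ * (√2)⁻¹ = (2 : ℝ)⁻¹ := by
      rw [← mul_inv, Real.mul_self_sqrt zero_le_two]
    simp only [lor, Prod.fst_add, Prod.smul_fst, Prod.snd_add, Prod.smul_snd, inner_add_left,
      inner_add_right, inner_smul_left, inner_smul_right, inner_neg_left, inner_neg_right, hb, hv,
      hv', hvv, smul_eq_mul, one_div, RCLike.conj_to_real]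
    linear_combination 2 * ‖v‖ ^ 2 * h2, by
    intro h
    have h1 := congrArg Prod.fst h
    simp only [Prod.fst_add, Prod.smul_fst, smul_eq_mul, mul_one, add_zero, Prod.fst_zero] at h1
    have : 0 < 1 / √2 := by positivity
    have : 0 ≤ ‖v‖ ^ 2 / 2 * (1 / √2) := by positivity
    linarith⟩

/-- The second model of `π_s`: a function `f` on `∂Hⁿ` extends to the function on the future light
cone which is homogeneous of degree `-(1/2 + s)(n - 1)` and whose value at `(1, b)/√2` is `f b`.
Composed with the orbit map `g ↦ g ξ₁` it is the function `F` on `Isom(Hⁿ)` with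
`F(g m g_{λ,v,Id}) = λ^(-(1/2 + s)(n - 1)) F(g)` and `F(k) = f(k ξ₁)` for `k ∈ O(n)`. -/
def coneExt {n : ℕ} (s : ℝ) (f : Bdry n → ℝ) (p : LightCone n) : ℝ :=
  (√2 * p.1.1) ^ (-((1 / 2 + s) * ((n : ℝ) - 1))) * f p.dir

/-- The intertwining integral `∫_{ℝⁿ⁻¹} F(k g_{1,v,Id} σ) dv`, at the boundary point `b = [k ξ₁]`. -/
def intertwineRaw {n : ℕ} (s : ℝ) (f : Bdry n → ℝ) (b : Bdry n) : ℝ :=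
  ∫ v : (ℝ ∙ (b : Euc n))ᗮ, coneExt s f (horo b v)

/-- The intertwining operator `L_s` from `π_s` to `π_{-s}`, normalized by `L_s 1 = 1`: the integral
is divided by its value on the constant function `1`, which is a constant. -/
def intertwine {n : ℕ} (s : ℝ) (f : Bdry n → ℝ) (b : Bdry n) : ℝ :=
  (∫ b', intertwineRaw s (fun _ => 1) b' ∂(bvol n))⁻¹ * intertwineRaw s f b

/-- The `π_s`-invariant bilinear form `⟨f, h⟩_s = ∫ f · L_s h`. -/
def form {n : ℕ} (s : ℝ) (f h : Bdry n → ℝ) : ℝ := ∫ b, f b * intertwine s h b ∂(bvol n)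

/-- The parameter `s` with `t = (n - 1)(s - 1/2)`. -/
def sParam (n : ℕ) (t : ℝ) : ℝ := 1 / 2 + t / ((n : ℝ) - 1)

/-! ### The integral kernel of the intertwining operator -/

section Kernel

open scoped Pointwise

variable {n : ℕ}

theorem horo_fst (b : Bdry n) (v : (ℝ ∙ (b : Euc n))ᗮ) :
    √2 * (horo b v).1.1 = 1 + ‖v‖ ^ 2 / 2 := by
  have h : √2 * (1 / √2) = 1 := by field_simp
  simp only [horo, Prod.fst_add, Prod.smul_fst, smul_eq_mul]
  linear_combination (‖v‖ ^ 2 / 2 + 1) * h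

theorem horo_snd (b : Bdry n) (v : (ℝ ∙ (b : Euc n))ᗮ) :
    (horo b v).1.2 = ((‖v‖ ^ 2 / 2 - 1) / √2) • b.1 + v.1 := by
  simp only [horo, Prod.snd_add, Prod.smul_snd]
  module

theorem horo_snd_norm (b : Bdry n) (v : (ℝ ∙ (b : Euc n))ᗮ) :
    ‖(horo b v).1.2‖ = (1 + ‖v‖ ^ 2 / 2) / √2 := by
  rw [← horo_fst b v, mul_div_cancel_left₀ _ (by positivity)]
  have h1 : 0 ≤ (horo b v).1.1 := by
    have := horo_fst b v
    have h2 : 0 < √2 * (horo b v).1.1 := by rw [this]; positivity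
    exact (pos_of_mul_pos_right h2 (by positivity)).le
  exact ((sq_eq_sq₀ h1 (norm_nonneg _)).1 (horo b v).sq_eq).symm

theorem measurePreserving_split (b : Bdry n) :
    MeasurePreserving (fun p : ℝ × (ℝ ∙ (b : Euc n))ᗮ => p.1 • b.1 + p.2.1) := by
  have hb : ‖b.1‖ = 1 := mem_sphere_zero_iff_norm.1 b.2
  let e := LinearIsometryEquiv.toSpanUnitSingleton (𝕜 := ℝ) b.1 hb
  have h1 := (e.measurePreserving).prod (MeasurePreserving.id (volume : Measure (ℝ ∙ (b : Euc n))ᗮ))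
  have h2 := WithLp.volume_preserving_toLp (ℝ ∙ (b : Euc n)) (ℝ ∙ (b : Euc n))ᗮ
  have h3 := ((ℝ ∙ (b : Euc n)).orthogonalDecomposition.symm).measurePreserving
  have h4 := h3.comp (h2.comp h1)
  have h5 : (fun p : ℝ × (ℝ ∙ (b : Euc n))ᗮ => p.1 • b.1 + p.2.1) =
      (ℝ ∙ (b : Euc n)).orthogonalDecomposition.symm ∘ WithLp.toLp 2 ∘ Prod.map e id := by
    ext p
    simp [e]
  rw [h5]
  exact h4

theorem finrank_perp (hn : n ≠ 0) (b : Bdry n) :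
    Module.finrank ℝ (ℝ ∙ (b : Euc n))ᗮ = n - 1 := by
  obtain ⟨m, rfl⟩ := Nat.exists_eq_succ_of_ne_zero hn
  have hb : b.1 ≠ 0 := by
    intro h
    have := mem_sphere_zero_iff_norm.1 b.2
    simp [h] at this
  have : Fact (Module.finrank ℝ (Euc (m + 1)) = m + 1) := ⟨by simp⟩
  exact Submodule.finrank_orthogonal_span_singleton (n := m) hb

/-- A one-dimensional substitution. -/
theorem lintegral_line (c : ℝ) (hc : 0 < c) (F : ℝ → ℝ≥0∞) :
    ∫⁻ r, F r = ∫⁻ a in Ioi (0 : ℝ), ENNReal.ofReal ((c / (2 * a ^ 2) + 1) / √2) *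
      F ((c / (2 * a) - a) / √2) := by
  have h2 : 0 < √2 := by positivity
  let φ : ℝ → ℝ := fun a => (c / (2 * a) - a) / √2
  have hd : ∀ a ∈ Ioi (0 : ℝ), HasDerivWithinAt φ (-((c / (2 * a ^ 2) + 1) / √2)) (Ioi 0) a := by
    intro a ha
    have ha' : a ≠ 0 := (mem_Ioi.1 ha).ne'
    have h1 : HasDerivAt (fun a : ℝ => c / 2 * a⁻¹) (c / 2 * (-(a ^ 2)⁻¹)) a :=
      (hasDerivAt_inv ha').const_mul _
    have h3 := ((h1.sub (hasDerivAt_id a)).div_const (√2)).hasDerivWithinAt (s := Ioi 0)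
    refine (h3.congr_deriv ?_).congr_of_eventuallyEq ?_ ?_
    · field_simp
      ring
    · refine Filter.Eventually.of_forall fun x => ?_
      simp only [φ, Pi.sub_apply, id]
      congr 2
      rw [div_eq_mul_inv, mul_inv]; ring
    · simp only [φ, Pi.sub_apply, id]
      congr 2
      rw [div_eq_mul_inv, mul_inv]; ring
  have hanti : StrictAntiOn φ (Ioi 0) := by
    intro x hx y hy hxy
    rw [mem_Ioi] at hx hy
    simp only [φ]
    have : c / (2 * y) ≤ c / (2 * x) := by gcongr
    exact div_lt_div_of_pos_right (by linarith) h2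
  have himg : φ '' Ioi 0 = univ := by
    refine eq_univ_of_forall fun r => ?_
    -- solve `a² + √2 r a - c/2 = 0`
    set q := √2 * r with hq
    have hD : |q| < √(q ^ 2 + 2 * c) := by
      rw [← Real.sqrt_sq_eq_abs]
      exact Real.sqrt_lt_sqrt (sq_nonneg _) (by linarith)
    have hsq : √(q ^ 2 + 2 * c) ^ 2 = q ^ 2 + 2 * c := Real.sq_sqrt (by positivity)
    have hpos : 0 < (√(q ^ 2 + 2 * c) - q) / 2 := by
      have := (le_abs_self q).trans_lt hD
      linarith
    refine ⟨(√(q ^ 2 + 2 * c) - q) / 2, hpos, ?_⟩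
    simp only [φ]
    rw [div_eq_iff h2.ne', mul_comm r, ← hq]
    have : 2 * ((√(q ^ 2 + 2 * c) - q) / 2) ≠ 0 := by positivity
    rw [sub_eq_iff_eq_add, div_eq_iff this]
    nlinarith
  have key := lintegral_image_eq_lintegral_abs_deriv_mul measurableSet_Ioi hd hanti.injOn F
  rw [himg, Measure.restrict_univ] at key
  rw [key]
  refine setLIntegral_congr_fun measurableSet_Ioi fun a ha => ?_
  have ha' : 0 < a := ha
  simp only [φ]
  rw [abs_neg, abs_of_nonneg (by positivity)]

theorem lintegral_scale {E : Type*} [NormedAddCommGroup E] [InnerProductSpace ℝ E]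
    [FiniteDimensional ℝ E] [MeasurableSpace E] [BorelSpace E] (G : E → ℝ≥0∞) (hG : Measurable G)
    {a : ℝ} (ha : 0 < a) :
    ∫⁻ y, G y = ENNReal.ofReal (a ^ Module.finrank ℝ E) * ∫⁻ v, G (a • v) := by
  have h1 := Measure.map_addHaar_smul (volume : Measure E) ha.ne'
  rw [← lintegral_map hG (measurable_const_smul a), h1, lintegral_smul_measure, smul_eq_mul,
    ← mul_assoc, ← ENNReal.ofReal_mul (by positivity), abs_inv, abs_of_pos (by positivity),
    mul_inv_cancel₀ (by positivity), ENNReal.ofReal_one, one_mul]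

/-- Polar coordinates adapted to the horospherical parametrization of the light cone. -/
theorem lintegral_cone (hn : 2 ≤ n) (b : Bdry n) (F : Euc n → ℝ≥0∞) (hF : Measurable F) :
    ∫⁻ x, F x = ∫⁻ v : (ℝ ∙ (b : Euc n))ᗮ, ∫⁻ a in Ioi (0 : ℝ),
      ENNReal.ofReal (a ^ (n - 1)) * (ENNReal.ofReal ((1 + ‖v‖ ^ 2 / 2) / √2) *
        F (a • (horo b v).1.2)) := by
  have hfr := finrank_perp (by omega) b
  have : Nontrivial (ℝ ∙ (b : Euc n))ᗮ := Module.nontrivial_of_finrank_pos (R := ℝ) (by omega)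
  rw [← (measurePreserving_split b).lintegral_comp hF, Measure.volume_eq_prod,
    lintegral_prod_symm' _ (by fun_prop)]
  have h1 : ∀ᵐ y : (ℝ ∙ (b : Euc n))ᗮ, ∫⁻ r : ℝ, F (r • b.1 + y.1) =
      ∫⁻ a in Ioi (0 : ℝ), ENNReal.ofReal ((‖y‖ ^ 2 / (2 * a ^ 2) + 1) / √2) *
      F (((‖y‖ ^ 2 / (2 * a) - a) / √2) • b.1 + y.1) := by
    filter_upwards [compl_mem_ae_iff.2 (measure_singleton (0 : (ℝ ∙ (b : Euc n))ᗮ))] with y hy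
    exact lintegral_line _ (by
      have h0 : 0 < ‖y‖ := norm_pos_iff.2 hy
      positivity) _
  rw [lintegral_congr_ae h1, lintegral_lintegral_swap (by fun_prop)]
  symm
  rw [lintegral_lintegral_swap]
  symm
  · refine setLIntegral_congr_fun measurableSet_Ioi fun a ha => ?_
    have ha' : 0 < a := ha
    rw [lintegral_scale _ (by fun_prop) ha', hfr, ← lintegral_const_mul _ (by fun_prop)]
    refine lintegral_congr fun v => ?_
    congr 2
    · congr 1
      rw [norm_smul, Real.norm_of_nonneg ha'.le]
      field_simp
      ring
    · congr 1
      rw [horo_snd, smul_add, smul_smul, norm_smul, Real.norm_of_nonneg ha'.le, Submodule.coe_smul]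
      congr 2
      field_simp
  · simp_rw [horo_snd]
    fun_prop

theorem horo_fst_pos (b : Bdry n) (v : (ℝ ∙ (b : Euc n))ᗮ) : 0 < (horo b v).1.1 := by
  have h2 : 0 < √2 * (horo b v).1.1 := by rw [horo_fst b v]; positivity
  exact pos_of_mul_pos_right h2 (by positivity)

theorem norm_smul_dir (b : Bdry n) (v : (ℝ ∙ (b : Euc n))ᗮ) :
    (horo b v).1.2 = ‖(horo b v).1.2‖ • (horo b v).dir.1 := by
  have h := horo_fst_pos b v
  rw [← (sq_eq_sq₀ h.le (norm_nonneg _)).1 (horo b v).sq_eq]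
  exact (smul_inv_smul₀ h.ne' _).symm

theorem measurableSet_sector {A : Set (Bdry n)} (hA : MeasurableSet A) :
    MeasurableSet (Ioo (0 : ℝ) 1 • ((↑) '' A : Set (Euc n))) := by
  have h : (Ioo (0 : ℝ) 1 • ((↑) '' A : Set (Euc n))) = Subtype.val ''
      (homeomorphUnitSphereProd (Euc n) ⁻¹' (A ×ˢ Iio ⟨1, mem_Ioi.2 one_pos⟩)) := by
    rw [← image2_smul, image2_image_right, ← Homeomorph.image_symm, image_image,
      show Ioo (0 : ℝ) 1 = Subtype.val '' Iio (⟨1, mem_Ioi.2 one_pos⟩ : Ioi (0 : ℝ)) from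
        (image_subtype_val_Ioi_Iio (⟨1, mem_Ioi.2 one_pos⟩ : Ioi (0 : ℝ))).symm, image2_image_left, image2_swap, ← image_prod]
    rfl
  rw [h]
  refine (MeasurableEmbedding.subtype_coe (measurableSet_singleton _).compl).measurableSet_image.2 ?_
  exact (homeomorphUnitSphereProd (Euc n)).measurable (hA.prod measurableSet_Iio)

theorem mem_sector (b : Bdry n) (v : (ℝ ∙ (b : Euc n))ᗮ) (A : Set (Bdry n)) {a : ℝ} (ha : 0 < a) :
    a • (horo b v).1.2 ∈ Ioo (0 : ℝ) 1 • ((↑) '' A : Set (Euc n)) ↔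
      a < √2 / (1 + ‖v‖ ^ 2 / 2) ∧ (horo b v).dir ∈ A := by
  have hN : 0 < (1 + ‖v‖ ^ 2 / 2) / √2 := by positivity
  have hlt : a < √2 / (1 + ‖v‖ ^ 2 / 2) ↔ a * ((1 + ‖v‖ ^ 2 / 2) / √2) < 1 := by
    rw [lt_div_iff₀ (by positivity), mul_div_assoc', div_lt_one (by positivity)]
  have hs := norm_smul_dir b v
  rw [horo_snd_norm] at hs
  rw [hlt, mem_smul]
  constructor
  · rintro ⟨r, hr, _, ⟨d, hd, rfl⟩, h⟩
    rw [hs, smul_smul] at h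
    have h1 := congrArg norm h
    rw [norm_smul, norm_smul, mem_sphere_zero_iff_norm.1 d.2,
      mem_sphere_zero_iff_norm.1 (horo b v).dir.2, mul_one, mul_one,
      Real.norm_of_nonneg hr.1.le, Real.norm_of_nonneg (by positivity)] at h1
    rw [← h1] at h ⊢
    refine ⟨hr.2, ?_⟩
    have : d = (horo b v).dir := Subtype.ext (smul_right_injective _ hr.1.ne' h)
    exact this ▸ hd
  · rintro ⟨h1, h2⟩
    refine ⟨_, ⟨by positivity, h1⟩, _, ⟨_, h2, rfl⟩, ?_⟩
    rw [hs, smul_smul]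

theorem continuous_horo (b : Bdry n) : Continuous fun v => (horo b v).1 := by
  have h : (fun v => (horo b v).1) = fun v : (ℝ ∙ (b : Euc n))ᗮ =>
    ((‖v‖ ^ 2 / 2) • ((1 / √2) • ((1, b.1) : Mink n)) + (1 / √2) • ((1, -b.1) : Mink n)
      + ((0, v.1) : Mink n)) := rfl
  rw [h]
  fun_prop

theorem continuous_horo_dir (b : Bdry n) : Continuous fun v => (horo b v).dir := by
  refine Continuous.subtype_mk ?_ _
  have h := continuous_horo b
  exact ((continuous_fst.comp h).inv₀ fun v => (horo_fst_pos b v).ne').smul (continuous_snd.comp h)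

/-- The density, with respect to `dv`, of (a multiple of) the spherical measure. -/
def dens (b : Bdry n) (v : (ℝ ∙ (b : Euc n))ᗮ) : ℝ := ((1 + ‖v‖ ^ 2 / 2) ^ (n - 1))⁻¹

theorem dens_pos (b : Bdry n) (v : (ℝ ∙ (b : Euc n))ᗮ) : 0 < dens b v := by
  unfold dens; positivity

theorem measurable_dens (b : Bdry n) : Measurable (dens b) := by
  unfold dens; fun_prop

/-- The spherical measure in horospherical (stereographic) coordinates. -/
theorem toSphere_eq_map (hn : 2 ≤ n) (b : Bdry n) :
    (volume : Measure (Euc n)).toSphere = ENNReal.ofReal (√2 ^ (n - 1)) •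
      (volume.withDensity fun v => ENNReal.ofReal (dens b v)).map fun v => (horo b v).dir := by
  ext A hA
  have hD : Measurable fun v => (horo b v).dir := (continuous_horo_dir b).measurable
  rw [Measure.toSphere_apply' _ hA, Measure.smul_apply, Measure.map_apply hD hA,
    withDensity_apply _ (hD hA), ← lintegral_indicator (hD hA),
    ← lintegral_indicator_one (measurableSet_sector hA),
    lintegral_cone hn b _ (measurable_one.indicator (measurableSet_sector hA)),
    smul_eq_mul, ← lintegral_const_mul' _ _ ENNReal.ofReal_ne_top,
    ← lintegral_const_mul' _ _ (by simp)]
  refine lintegral_congr fun v => ?_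
  set l := 1 + ‖v‖ ^ 2 / 2 with hl
  have hlpos : 0 < l := by positivity
  have h1 : ∫⁻ a in Ioi (0 : ℝ), ENNReal.ofReal (a ^ (n - 1)) * (ENNReal.ofReal (l / √2) *
      (Ioo (0 : ℝ) 1 • ((↑) '' A : Set (Euc n))).indicator 1 (a • (horo b v).1.2)) =
      ∫⁻ a in Ioi (0 : ℝ), (Iio (√2 / l)).indicator (fun a => ENNReal.ofReal (a ^ (n - 1))) a *
        (ENNReal.ofReal (l / √2) * A.indicator 1 (horo b v).dir) := by
    refine setLIntegral_congr_fun measurableSet_Ioi fun a ha => ?_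
    have h := mem_sector b v A (mem_Ioi.1 ha)
    rw [← hl] at h
    by_cases h2 : a < √2 / l <;> by_cases h3 : (horo b v).dir ∈ A <;>
      simp [indicator, h, h2, h3]
  rw [h1, lintegral_mul_const _ (by measurability), setLIntegral_indicator measurableSet_Iio,
    Iio_inter_Ioi]
  have h2 : ∫⁻ a in Ioo 0 (√2 / l), ENNReal.ofReal (a ^ (n - 1)) =
      ENNReal.ofReal ((√2 / l) ^ n / n) := by
    have h0 : (0 : ℝ) ≤ √2 / l := by positivity
    rw [Measure.restrict_congr_set Ioo_ae_eq_Ioc,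
      ← ofReal_integral_eq_lintegral_ofReal (intervalIntegral.intervalIntegrable_pow _).1,
      ← intervalIntegral.integral_of_le h0]
    · congr 1
      rw [integral_pow]
      have : n - 1 + 1 = n := by omega
      rw [this, zero_pow (by omega), sub_zero]
      congr 1
      exact_mod_cast this
    · filter_upwards [ae_restrict_mem measurableSet_Ioc] with y hy
      exact pow_nonneg hy.1.le _
  rw [h2]
  by_cases h3 : (horo b v).dir ∈ A
  · have h4 : v ∈ (fun v => (horo b v).dir) ⁻¹' A := h3
    rw [indicator_of_mem h3, indicator_of_mem h4, Pi.one_apply, mul_one, dens, ← hl,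
      ← ENNReal.ofReal_mul (by positivity), ← ENNReal.ofReal_mul (by positivity), finrank_euclideanSpace_fin,
      ← ENNReal.ofReal_natCast, ← ENNReal.ofReal_mul (by positivity)]
    congr 1
    obtain ⟨m, rfl⟩ : ∃ m, n = m + 1 := ⟨n - 1, by omega⟩
    rw [Nat.add_sub_cancel, div_pow, pow_succ, pow_succ]
    field_simp
  · have h4 : v ∉ (fun v => (horo b v).dir) ⁻¹' A := h3
    rw [indicator_of_notMem h3, indicator_of_notMem h4]
    simp

end Kernel

/-! ### The integral kernel is conditionally of negative type -/

section NegativeType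

variable {n : ℕ} {μ : Measure (Bdry n)} [IsFiniteMeasure μ] {f : Bdry n → ℝ}

theorem abs_inner_le (z : Bdry n × Bdry n) : |⟪z.1.1, z.2.1⟫| ≤ 1 := by
  have h := abs_real_inner_le_norm z.1.1 z.2.1
  rwa [mem_sphere_zero_iff_norm.1 z.1.2, mem_sphere_zero_iff_norm.1 z.2.2, one_mul] at h

theorem continuous_inner_prod : Continuous fun z : Bdry n × Bdry n => ⟪z.1.1, z.2.1⟫ := by
  fun_prop

theorem integral_pow_nonneg (hf : Integrable f μ) (k : ℕ) :
    0 ≤ ∫ z, ⟪z.1.1, z.2.1⟫ ^ k * (f z.1 * f z.2) ∂(μ.prod μ) := by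
  have h1 : ∀ z : Bdry n × Bdry n, ⟪z.1.1, z.2.1⟫ ^ k * (f z.1 * f z.2) =
      ∑ p : Fin k → Fin n, ((∏ j, z.1.1 (p j)) * f z.1) * ((∏ j, z.2.1 (p j)) * f z.2) := by
    intro z
    have : ⟪z.1.1, z.2.1⟫ ^ k = ∑ p : Fin k → Fin n, ∏ j, (z.2.1 (p j) * z.1.1 (p j)) := by
      rw [PiLp.inner_apply, ← Fin.prod_const, Finset.prod_univ_sum]
      simp
    rw [this, Finset.sum_mul]
    refine Finset.sum_congr rfl fun p _ => ?_
    rw [Finset.prod_mul_distrib]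
    ring
  have h2 : ∀ p : Fin k → Fin n, Integrable (fun x : Bdry n => (∏ j, x.1 (p j)) * f x) μ := by
    intro p
    refine hf.bdd_mul (c := 1) (by fun_prop) (Filter.Eventually.of_forall fun x => ?_)
    rw [norm_prod]
    refine Finset.prod_le_one (fun _ _ => norm_nonneg _) fun j _ => ?_
    exact (PiLp.norm_apply_le x.1 (p j)).trans (mem_sphere_zero_iff_norm.1 x.2).le
  simp_rw [h1]
  rw [integral_finsetSum _ fun p _ => (h2 p).mul_prod (h2 p)]
  refine Finset.sum_nonneg fun p _ => ?_
  rw [integral_prod_mul (fun x : Bdry n => (∏ j, x.1 (p j)) * f x)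
    (fun x : Bdry n => (∏ j, x.1 (p j)) * f x)]
  exact mul_self_nonneg _

theorem integral_resolvent_nonneg (hf : Integrable f μ) {a : ℝ} (ha : 1 < a) :
    0 ≤ ∫ z, (a - ⟪z.1.1, z.2.1⟫)⁻¹ * (f z.1 * f z.2) ∂(μ.prod μ) := by
  have ha0 : 0 < a := by linarith
  have hW : Integrable (fun z : Bdry n × Bdry n => f z.1 * f z.2) (μ.prod μ) := hf.mul_prod hf
  have hg : HasSum (fun k : ℕ => (a⁻¹) ^ k) (1 - a⁻¹)⁻¹ :=
    hasSum_geometric_of_lt_one (by positivity) (inv_lt_one_of_one_lt₀ ha)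
  have hb : ∀ z : Bdry n × Bdry n, HasSum (fun k : ℕ => (a⁻¹) ^ k * (a⁻¹ * |f z.1 * f z.2|))
      ((1 - a⁻¹)⁻¹ * (a⁻¹ * |f z.1 * f z.2|)) := fun z => hg.mul_right _
  have key := hasSum_integral_of_dominated_convergence (μ := μ.prod μ)
    (F := fun (k : ℕ) z => (a⁻¹) ^ (k + 1) * (⟪z.1.1, z.2.1⟫ ^ k * (f z.1 * f z.2)))
    (f := fun z => (a - ⟪z.1.1, z.2.1⟫)⁻¹ * (f z.1 * f z.2))
    (fun k z => (a⁻¹) ^ k * (a⁻¹ * |f z.1 * f z.2|)) ?_ ?_ ?_ ?_ ?_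
  · refine key.nonneg fun k => ?_
    rw [integral_const_mul]
    exact mul_nonneg (by positivity) (integral_pow_nonneg hf k)
  · intro k
    have := hW.aestronglyMeasurable
    exact ((continuous_inner_prod.pow k).aestronglyMeasurable.mul this).const_mul _
  · intro k
    refine Filter.Eventually.of_forall fun z => ?_
    have h1 : |⟪z.1.1, z.2.1⟫| ^ k ≤ 1 := pow_le_one₀ (abs_nonneg _) (abs_inner_le z)
    rw [norm_mul, norm_mul, norm_pow, norm_pow, Real.norm_eq_abs, Real.norm_eq_abs, Real.norm_eq_abs,
      abs_of_pos (by positivity : 0 < a⁻¹), pow_succ, mul_assoc]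
    gcongr
    exact mul_le_of_le_one_left (abs_nonneg _) h1
  · exact Filter.Eventually.of_forall fun z => (hb z).summable
  · simp_rw [fun z => (hb z).tsum_eq]
    exact (hW.abs.const_mul _).const_mul _
  · refine Filter.Eventually.of_forall fun z => ?_
    have h1 : |a⁻¹ * ⟪z.1.1, z.2.1⟫| < 1 := by
      rw [abs_mul, abs_of_pos (by positivity : 0 < a⁻¹)]
      calc a⁻¹ * |⟪z.1.1, z.2.1⟫| ≤ a⁻¹ * 1 := by gcongr; exact abs_inner_le z
        _ < 1 := by rw [mul_one]; exact inv_lt_one_of_one_lt₀ ha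
    have h2 := (hasSum_geometric_of_abs_lt_one h1).mul_left (a⁻¹)
    have h3 : a - ⟪z.1.1, z.2.1⟫ ≠ 0 := by
      have := (le_abs_self _).trans (abs_inner_le z)
      linarith
    have h4 : a⁻¹ * (1 - a⁻¹ * ⟪z.1.1, z.2.1⟫)⁻¹ = (a - ⟪z.1.1, z.2.1⟫)⁻¹ := by
      rw [← mul_inv, mul_sub, mul_one, mul_inv_cancel_left₀ ha0.ne']
    rw [h4] at h2
    have h5 : (fun k : ℕ => (a⁻¹) ^ (k + 1) * (⟪z.1.1, z.2.1⟫ ^ k * (f z.1 * f z.2))) =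
        fun k : ℕ => a⁻¹ * (a⁻¹ * ⟪z.1.1, z.2.1⟫) ^ k * (f z.1 * f z.2) := by
      funext k
      rw [mul_pow, pow_succ]
      ring
    rw [h5]
    exact h2.mul_right (f z.1 * f z.2)

theorem integral_kernel_nonpos (hf : Integrable f μ) (h0 : ∫ x, f x ∂μ = 0) {t : ℝ}
    (ht : t ∈ Ioo (0 : ℝ) 1) :
    ∫ z, ((1 - ⟪z.1.1, z.2.1⟫) / 2) ^ t * (f z.1 * f z.2) ∂(μ.prod μ) ≤ 0 := by
  have hW : Integrable (fun z : Bdry n × Bdry n => f z.1 * f z.2) (μ.prod μ) := hf.mul_prod hf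
  have hW0 : ∫ z, f z.1 * f z.2 ∂(μ.prod μ) = 0 := by
    rw [integral_prod_mul f f, h0, zero_mul]
  set w : Bdry n × Bdry n → ℝ := fun z => (1 - ⟪z.1.1, z.2.1⟫) / 2 with hw
  have hw0 : ∀ z, 0 ≤ w z := fun z => by
    have := (le_abs_self _).trans (abs_inner_le z)
    simp only [hw]; linarith
  have hw1 : ∀ z, w z ≤ 1 := fun z => by
    have := (neg_le_abs _).trans (abs_inner_le z)
    simp only [hw]; linarith
  have hwm : Measurable w := by
    have := (continuous_inner_prod (n := n)).measurable
    fun_prop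
  set C := ∫ l in Ioi 0, Real.rpowIntegrand₀₁ t l 1 with hC
  have hCpos : 0 < C := Real.integral_rpowIntegrand₀₁_one_pos ht
  have hint : Integrable (fun q : (Bdry n × Bdry n) × ℝ =>
      Real.rpowIntegrand₀₁ t q.2 (w q.1) * (f q.1.1 * f q.1.2))
      ((μ.prod μ).prod (volume.restrict (Ioi 0))) := by
    have hdom : Integrable (fun q : (Bdry n × Bdry n) × ℝ =>
      (f q.1.1 * f q.1.2) * Real.rpowIntegrand₀₁ t q.2 1)
      ((μ.prod μ).prod (volume.restrict (Ioi 0))) :=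
      hW.mul_prod (Real.integrableOn_rpowIntegrand₀₁_Ioi ht zero_le_one)
    refine hdom.mono ?_ ?_
    · refine AEStronglyMeasurable.mul ?_ hW.aestronglyMeasurable.comp_fst
      refine Measurable.aestronglyMeasurable ?_
      unfold Real.rpowIntegrand₀₁
      fun_prop
    · have h1 : ∀ᵐ q : (Bdry n × Bdry n) × ℝ ∂((μ.prod μ).prod (volume.restrict (Ioi 0))),
          q.2 ∈ Ioi (0 : ℝ) :=
        Measure.quasiMeasurePreserving_snd.ae (ae_restrict_mem measurableSet_Ioi)
      filter_upwards [h1] with q hq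
      have hq' : 0 ≤ q.2 := (mem_Ioi.1 hq).le
      rw [norm_mul, norm_mul (f q.1.1 * f q.1.2), mul_comm,
        Real.norm_of_nonneg (Real.rpowIntegrand₀₁_nonneg ht.1 hq' (hw0 _)),
        Real.norm_of_nonneg (Real.rpowIntegrand₀₁_nonneg ht.1 hq' zero_le_one)]
      gcongr
      exact Real.rpowIntegrand₀₁_monotoneOn ht hq' (hw0 _) (mem_Ici.2 zero_le_one) (hw1 _)
  have h1 : C * ∫ z, w z ^ t * (f z.1 * f z.2) ∂(μ.prod μ) =
      ∫ l in Ioi 0, ∫ z, Real.rpowIntegrand₀₁ t l (w z) * (f z.1 * f z.2) ∂(μ.prod μ) := by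
    rw [← integral_const_mul, ← integral_integral_swap hint]
    refine integral_congr_ae (Filter.Eventually.of_forall fun z => ?_)
    simp only
    rw [integral_mul_const, Real.integral_rpowIntegrand₀₁_eq_rpow_mul_const ht (hw0 z)]
    ring
  have h2 : ∫ l in Ioi 0, ∫ z, Real.rpowIntegrand₀₁ t l (w z) * (f z.1 * f z.2) ∂(μ.prod μ) ≤ 0 := by
    refine setIntegral_nonpos measurableSet_Ioi fun l hl => ?_
    have hl0 : 0 < l := hl
    have h3 : ∀ z, Real.rpowIntegrand₀₁ t l (w z) * (f z.1 * f z.2) =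
        l ^ t * l⁻¹ * (f z.1 * f z.2) -
          2 * l ^ t * ((2 * l + 1 - ⟪z.1.1, z.2.1⟫)⁻¹ * (f z.1 * f z.2)) := by
      intro z
      have h4 : (l + w z)⁻¹ = 2 * (2 * l + 1 - ⟪z.1.1, z.2.1⟫)⁻¹ := by
        have h5 : l + w z = (2 * l + 1 - ⟪z.1.1, z.2.1⟫) / 2 := by simp only [hw]; ring
        rw [h5, inv_div, div_eq_mul_inv]
      rw [Real.rpowIntegrand₀₁, h4]
      ring
    simp_rw [h3]
    rw [integral_sub (hW.const_mul _), integral_const_mul, integral_const_mul, hW0, mul_zero, zero_sub]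
    · have := integral_resolvent_nonneg hf (by linarith : 1 < 2 * l + 1)
      have h6 : 0 ≤ l ^ t := by positivity
      rw [neg_nonpos]
      positivity
    · refine Integrable.const_mul (hW.bdd_mul (c := (2 * l)⁻¹) ?_ ?_) _
      · have := (continuous_inner_prod (n := n)).measurable
        exact Measurable.aestronglyMeasurable (by fun_prop)
      · refine Filter.Eventually.of_forall fun z => ?_
        have := (le_abs_self _).trans (abs_inner_le z)
        rw [norm_inv, Real.norm_of_nonneg (by linarith)]
        gcongr
        linarith
  rw [← h1] at h2
  exact nonpos_of_mul_nonpos_right h2 hCpos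

end NegativeType

/-! ### The form `⟨·, ·⟩_s` through the integral kernel -/

section FormKernel

variable {n : ℕ}

instance : IsFiniteMeasure (bvol n) := by
  refine ⟨?_⟩
  rw [bvol, Measure.smul_apply, smul_eq_mul]
  exact (ENNReal.inv_mul_le_one _).trans_lt ENNReal.one_lt_top

theorem toSphere_eq_smul_bvol (hn : 2 ≤ n) : (volume : Measure (Euc n)).toSphere =
    (volume : Measure (Euc n)).toSphere univ • bvol n := by
  have : Nonempty (Fin n) := ⟨⟨0, by omega⟩⟩
  have h0 : (volume : Measure (Euc n)).toSphere univ ≠ 0 := by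
    rw [Ne, Measure.measure_univ_eq_zero]
    exact Measure.toSphere_ne_zero _
  rw [bvol, smul_smul, ENNReal.mul_inv_cancel h0 (measure_ne_top _ _), one_smul]

theorem horo_inner_dir (b : Bdry n) (v : (ℝ ∙ (b : Euc n))ᗮ) :
    (1 - ⟪b.1, (horo b v).dir.1⟫) / 2 = (1 + ‖v‖ ^ 2 / 2)⁻¹ := by
  have hb : ⟪b.1, b.1⟫ = 1 := by
    rw [real_inner_self_eq_norm_sq, mem_sphere_zero_iff_norm.1 b.2, one_pow]
  have hv : ⟪b.1, v.1⟫ = 0 := (Submodule.mem_orthogonal_singleton_iff_inner_right).1 v.2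
  have h1 : (horo b v).1.1 = (1 + ‖v‖ ^ 2 / 2) / √2 := by
    rw [← horo_fst b v, mul_div_cancel_left₀ _ (by positivity)]
  have h2 : (horo b v).dir.1 = (horo b v).1.1⁻¹ • (horo b v).1.2 := rfl
  rw [h2, inner_smul_right, horo_snd, inner_add_right, inner_smul_right, hb, hv, h1]
  field_simp
  ring

/-- The constant in the kernel formula. -/
def kernelConst (n : ℕ) : ℝ :=
  ((volume : Measure (Euc n)).toSphere univ).toReal * (√2 ^ (n - 1))⁻¹

theorem kernelConst_nonneg (n : ℕ) : 0 ≤ kernelConst n := by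
  unfold kernelConst; positivity

theorem intertwineRaw_eq (hn : 2 ≤ n) (t : ℝ) {f : Bdry n → ℝ}
    (hf : AEStronglyMeasurable f (bvol n)) (b : Bdry n) :
    intertwineRaw (sParam n t) f b =
      kernelConst n * ∫ b', ((1 - ⟪b.1, b'.1⟫) / 2) ^ t * f b' ∂(bvol n) := by
  have hT := toSphere_eq_smul_bvol hn
  have hmap := toSphere_eq_map hn b
  have hc : ENNReal.ofReal (√2 ^ (n - 1)) ≠ 0 := by
    simp only [ne_eq, ENNReal.ofReal_eq_zero, not_le]; positivity
  have hD : Measurable fun v => (horo b v).dir := (continuous_horo_dir b).measurable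
  set ν := (volume.withDensity fun v => ENNReal.ofReal (dens b v)).map fun v => (horo b v).dir with hν
  have hk : Measurable fun b' : Bdry n => ((1 - ⟪b.1, b'.1⟫) / 2) ^ t := by
    have : Continuous fun b' : Bdry n => ⟪b.1, b'.1⟫ := by fun_prop
    have := this.measurable
    fun_prop
  have hfT : AEStronglyMeasurable f (volume : Measure (Euc n)).toSphere := by
    rw [hT]; exact hf.smul_measure _
  have hfν : AEStronglyMeasurable f ν := by
    have h : ν = (ENNReal.ofReal (√2 ^ (n - 1)))⁻¹ • (volume : Measure (Euc n)).toSphere := by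
      rw [hmap, smul_smul, ENNReal.inv_mul_cancel hc ENNReal.ofReal_ne_top, one_smul]
    rw [h]; exact hfT.smul_measure _
  have h1 : intertwineRaw (sParam n t) f b = ∫ b', ((1 - ⟪b.1, b'.1⟫) / 2) ^ t * f b' ∂ν := by
    have hm : AEStronglyMeasurable (fun b' : Bdry n => ((1 - ⟪b.1, b'.1⟫) / 2) ^ t * f b') ν :=
      hk.aestronglyMeasurable.mul hfν
    rw [hν, integral_map hD.aemeasurable hm,
      integral_withDensity_eq_integral_toReal_smul (measurable_dens b).ennreal_ofReal
        (Filter.Eventually.of_forall fun _ => ENNReal.ofReal_lt_top)]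
    refine integral_congr_ae (Filter.Eventually.of_forall fun v => ?_)
    simp only
    have hl : 0 < 1 + ‖v‖ ^ 2 / 2 := by positivity
    have hs : (1 / 2 + sParam n t) * ((n : ℝ) - 1) = ((n - 1 : ℕ) : ℝ) + t := by
      have h2 : (n : ℝ) - 1 ≠ 0 := by
        have : (2 : ℝ) ≤ n := by exact_mod_cast hn
        linarith
      rw [sParam, Nat.cast_sub (by omega), Nat.cast_one]
      field_simp
      ring
    rw [coneExt, horo_fst, hs, horo_inner_dir, ENNReal.toReal_ofReal (dens_pos b v).le, dens,
      smul_eq_mul, Real.rpow_neg hl.le, Real.rpow_add hl, Real.rpow_natCast, mul_inv,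
      Real.inv_rpow hl.le, mul_assoc]
  have h2 : ∫ b', ((1 - ⟪b.1, b'.1⟫) / 2) ^ t * f b' ∂(volume : Measure (Euc n)).toSphere =
      √2 ^ (n - 1) * ∫ b', ((1 - ⟪b.1, b'.1⟫) / 2) ^ t * f b' ∂ν := by
    rw [hmap, integral_smul_measure, ENNReal.toReal_ofReal (by positivity), smul_eq_mul]
  rw [hT, integral_smul_measure, smul_eq_mul] at h2
  rw [h1, kernelConst, mul_right_comm, h2]
  field_simp

/-- The constant in the kernel formula for the normalized form. -/
def formConst (n : ℕ) (t : ℝ) : ℝ :=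
  (∫ b', intertwineRaw (sParam n t) (fun _ => 1) b' ∂(bvol n))⁻¹ * kernelConst n

theorem formConst_nonneg (hn : 2 ≤ n) (t : ℝ) : 0 ≤ formConst n t := by
  refine mul_nonneg (inv_nonneg.2 (integral_nonneg fun b => ?_)) (kernelConst_nonneg n)
  rw [intertwineRaw_eq hn t aestronglyMeasurable_const]
  refine mul_nonneg (kernelConst_nonneg n) (integral_nonneg fun b' => ?_)
  have := (le_abs_self _).trans (abs_inner_le (b, b'))
  have : 0 ≤ (1 - ⟪b.1, b'.1⟫) / 2 := by simp only at this; linarith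
  simp only [Pi.zero_apply]
  positivity

theorem integrable_kernel {t : ℝ} (ht : 0 ≤ t) {f h : Bdry n → ℝ} (hf : Integrable f (bvol n))
    (hh : Integrable h (bvol n)) :
    Integrable (fun z : Bdry n × Bdry n => ((1 - ⟪z.1.1, z.2.1⟫) / 2) ^ t * (f z.1 * h z.2))
      ((bvol n).prod (bvol n)) := by
  refine (hf.mul_prod hh).bdd_mul (c := 1) ?_ (Filter.Eventually.of_forall fun z => ?_)
  · have := (continuous_inner_prod (n := n)).measurable
    exact Measurable.aestronglyMeasurable (by fun_prop)
  · have h1 := (le_abs_self _).trans (abs_inner_le z)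
    have h2 := (neg_le_abs _).trans (abs_inner_le z)
    have h3 : 0 ≤ (1 - ⟪z.1.1, z.2.1⟫) / 2 := by linarith
    rw [Real.norm_of_nonneg (by positivity)]
    exact Real.rpow_le_one h3 (by linarith) ht

theorem form_eq (hn : 2 ≤ n) {t : ℝ} (ht : 0 ≤ t) {f h : Bdry n → ℝ} (hf : Integrable f (bvol n))
    (hh : Integrable h (bvol n)) :
    form (sParam n t) f h = formConst n t *
      ∫ z, ((1 - ⟪z.1.1, z.2.1⟫) / 2) ^ t * (f z.1 * h z.2) ∂((bvol n).prod (bvol n)) := by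
  rw [integral_prod _ (integrable_kernel ht hf hh), form, ← integral_const_mul]
  refine integral_congr_ae (Filter.Eventually.of_forall fun b => ?_)
  simp only
  rw [intertwine, intertwineRaw_eq hn t hh.aestronglyMeasurable, ← mul_assoc (_⁻¹),
    show (∫ b', intertwineRaw (sParam n t) (fun _ => 1) b' ∂(bvol n))⁻¹ * kernelConst n =
      formConst n t from rfl, mul_left_comm]
  congr 1
  rw [← integral_const_mul]
  refine integral_congr_ae (Filter.Eventually.of_forall fun b' => ?_)
  simp only
  ring

theorem form_symm (hn : 2 ≤ n) {t : ℝ} (ht : 0 ≤ t) {f h : Bdry n → ℝ} (hf : Integrable f (bvol n))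
    (hh : Integrable h (bvol n)) : form (sParam n t) f h = form (sParam n t) h f := by
  rw [form_eq hn ht hf hh, form_eq hn ht hh hf, ← integral_prod_swap]
  congr 1
  refine integral_congr_ae (Filter.Eventually.of_forall fun z => ?_)
  simp only [Prod.fst_swap, Prod.snd_swap]
  rw [real_inner_comm, mul_comm (f z.2)]

theorem form_add_left (hn : 2 ≤ n) {t : ℝ} (ht : 0 ≤ t) {f f' h : Bdry n → ℝ}
    (hf : Integrable f (bvol n)) (hf' : Integrable f' (bvol n)) (hh : Integrable h (bvol n)) :
    form (sParam n t) (f + f') h = form (sParam n t) f h + form (sParam n t) f' h := by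
  rw [form_eq hn ht (hf.add hf') hh, form_eq hn ht hf hh, form_eq hn ht hf' hh, ← mul_add,
    ← integral_add (integrable_kernel ht hf hh) (integrable_kernel ht hf' hh)]
  congr 1
  refine integral_congr_ae (Filter.Eventually.of_forall fun z => ?_)
  simp only [Pi.add_apply]
  ring

theorem form_smul_left (s c : ℝ) (f h : Bdry n → ℝ) : form s (c • f) h = c * form s f h := by
  rw [form, form, ← integral_const_mul]
  refine integral_congr_ae (Filter.Eventually.of_forall fun z => ?_)
  simp only [Pi.smul_apply, smul_eq_mul]
  ring

theorem form_self_nonpos (hn : 2 ≤ n) {t : ℝ} (ht : t ∈ Ioo (0 : ℝ) 1) {f : Bdry n → ℝ}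
    (hf : Integrable f (bvol n)) (h0 : ∫ b, f b ∂(bvol n) = 0) : form (sParam n t) f f ≤ 0 := by
  rw [form_eq hn ht.1.le hf hf]
  exact mul_nonpos_of_nonneg_of_nonpos (formConst_nonneg hn t) (integral_kernel_nonpos hf h0 ht)

end FormKernel

/-! ### The hyperbolic space `H^∞_t` -/

/-- The real square integrable functions on `∂Hⁿ` with mean zero: the Hilbert sum of the spaces
`Hᵏ`, `k ≥ 1`, of spherical harmonics. -/
def meanZero (n : ℕ) : Submodule ℝ (Bdry n → ℝ) where
  carrier := {f | MemLp f 2 (bvol n) ∧ ∫ b, f b ∂(bvol n) = 0}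
  add_mem' := by
    rintro f h ⟨hf, hf0⟩ ⟨hh, hh0⟩
    refine ⟨hf.add hh, ?_⟩
    simp only [Pi.add_apply]
    rw [integral_add (hf.integrable one_le_two) (hh.integrable one_le_two), hf0, hh0, add_zero]
  zero_mem' := ⟨MemLp.zero, by simp⟩
  smul_mem' := by
    rintro c f ⟨hf, hf0⟩
    refine ⟨hf.const_smul c, ?_⟩
    simp only [Pi.smul_apply]
    rw [integral_smul, hf0, smul_zero]

/-- The space `meanZero n`, to be endowed with the inner product `-⟨·, ·⟩_s`. -/
def PreV (n : ℕ) (_ : Ioo (0 : ℝ) 1) : Type := meanZero n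

section Ambient

variable (n : ℕ) [n.AtLeastTwo] (t : Ioo (0 : ℝ) 1)

instance : AddCommGroup (PreV n t) := inferInstanceAs (AddCommGroup (meanZero n))

instance : Module ℝ (PreV n t) := inferInstanceAs (Module ℝ (meanZero n))

/-- The positive inner product `-⟨·, ·⟩_s`, where `t = (n - 1)(s - 1/2)`. -/
instance preVCore : PreInnerProductSpace.Core ℝ (PreV n t) where
  inner f h := -form (sParam n t) f.1 h.1
  conj_inner_symm f h := by
    rw [RCLike.conj_to_real, form_symm Nat.AtLeastTwo.prop t.2.1.le
      (f.2.1.integrable one_le_two) (h.2.1.integrable one_le_two)]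
  re_inner_nonneg f := by
    rw [RCLike.re_to_real, neg_nonneg]
    exact form_self_nonpos Nat.AtLeastTwo.prop t.2 (f.2.1.integrable one_le_two) f.2.2
  add_left f f' h := by
    have := form_add_left Nat.AtLeastTwo.prop t.2.1.le (f.2.1.integrable one_le_two)
      (f'.2.1.integrable one_le_two) (h.2.1.integrable one_le_two)
    rw [← neg_add, ← this]
    rfl
  smul_left f h c := by
    have := form_smul_left (sParam n t) c f.1 h.1
    rw [RCLike.conj_to_real, mul_neg, ← this]
    rfl

instance : SeminormedAddCommGroup (PreV n t) :=
  InnerProductSpace.Core.toSeminormedAddCommGroup (𝕜 := ℝ)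

instance : InnerProductSpace ℝ (PreV n t) := InnerProductSpace.ofCore (preVCore n t)

/-- The Hilbert space `V`: the completion of `⊕_{k ≥ 1} Hᵏ` with respect to `-⟨·, ·⟩_s`. -/
abbrev CompV : Type := UniformSpace.Completion (PreV n t)

/-- The space `H⁰ ⊕ V`; the space `H⁰` of constant functions is identified with `ℝ`. -/
abbrev Ambient : Type := ℝ × CompV n t

variable {n t}

/-- The extension of `⟨·, ·⟩_s` to `H⁰ ⊕ V`. -/
def ambForm (x y : Ambient n t) : ℝ := x.1 * y.1 - ⟪x.2, y.2⟫

variable (n t)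

/-- The hyperbolic space `H^∞_t` of the pair `(H⁰ ⊕ V, ⟨·, ·⟩_s)`, in the hyperboloid model. -/
def hypSpaceInf : Set (Ambient n t) := {x | ambForm x x = 1 ∧ 0 < x.1}

/-- The point `∗` of `H^∞_t`: the constant function `1`. -/
def basePoint : Ambient n t := (1, 0)

variable {n t}

/-- The distance of `H^∞_t`: `cosh d(x, y) = ⟨x, y⟩_s`. -/
def hypDist (x y : Ambient n t) : ℝ := Real.arcosh (ambForm x y)

theorem isProbabilityMeasure_bvol (n : ℕ) [n.AtLeastTwo] : IsProbabilityMeasure (bvol n) := by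
  have hn : 2 ≤ n := Nat.AtLeastTwo.prop
  have : Nonempty (Fin n) := ⟨⟨0, by omega⟩⟩
  have h0 : (volume : Measure (Euc n)).toSphere univ ≠ 0 := by
    rw [Ne, Measure.measure_univ_eq_zero]
    exact Measure.toSphere_ne_zero _
  exact ⟨by rw [bvol, Measure.smul_apply, smul_eq_mul, ENNReal.inv_mul_cancel h0 (measure_ne_top _ _)]⟩

variable (t)

/-- The embedding of `L²(∂Hⁿ, ℝ)` into `H⁰ ⊕ V`: the mean, and the component of mean zero. -/
def ofL2 (f : Bdry n → ℝ) (hf : MemLp f 2 (bvol n)) : Ambient n t :=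
  (∫ b, f b ∂(bvol n), ((show PreV n t from ⟨fun b => f b - ∫ b', f b' ∂(bvol n), by
    have := isProbabilityMeasure_bvol n
    refine ⟨hf.sub (memLp_const _), ?_⟩
    rw [integral_sub (hf.integrable one_le_two) (integrable_const _)]
    simp⟩ : PreV n t) : CompV n t))

end Ambient

end

end HypRenorm

open HypRenorm

/-! An isometry `g` sends the isotropic vector `(1, b)` to `λ(b) (1, gb)` with `λ = stretch g > 0`,
and everything is expressed through `λ`. The action on the sphere is conformal, with Jacobian
`λ^{-(n-1)}` (`map_bdryAct_inv`, `jac_ae_eq`). As `1/2 + s = 1 + t/(n-1)`, the substitution `b ↦ gb`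
turns the integral of `π_s(g)∗` into that of `λ^t`, and the Jacobian cancels all but `λ^t`
(`confDens_mul_orbitFun`). Since `L_s 1 = 1`, pairing with `∗` is taking the mean, so `cosh
d(π_s(g)∗, ∗) = ∫ λ^t`.

The orbit point lies on the hyperboloid because the chord kernel `((1 - ⟨b, b'⟩)/2)^t` of `L_s`
picks up the factor `λ(b)^{-t} λ(b')^{-t}` under `g` (`chordKernel_bdryAct`). Hence `⟨π_s(g)∗,
π_s(g)∗⟩_s = ⟨1, 1⟩_s = 1` (`form_orbitFun`).

For the asymptotics, `1 + t ∫ log λ ≤ ∫ λ^t ≤ 1 + t ∫ (λ - 1)`. With `1 + d²/2 ≤ cosh d ≤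
exp(d²/2)`, this makes `d²/t` bounded, and bounded below as soon as `∫ log λ > 0`. That positivity
is strict Jensen: `λ^{-(n-1)}` has mean 1, and it is constant only if `λ = 1`, that is, only if `g`
fixes `o` (`integral_log_stretch_pos`, `stretch_eq_one_iff`). -/

namespace HypRenorm

noncomputable section

/-! ### Stretch factors and the conformal action on the boundary. -/

section Conformal

variable {n : ℕ}

theorem lor_comm (x y : Mink n) : lor x y = lor y x := by
  rw [lor, lor, mul_comm, real_inner_comm]

theorem lor_smul_left (c : ℝ) (x y : Mink n) : lor (c • x) y = c * lor x y := by
  simp only [lor, Prod.smul_fst, Prod.smul_snd, smul_eq_mul, real_inner_smul_left]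
  ring

theorem lor_smul_right (c : ℝ) (x y : Mink n) : lor x (c • y) = c * lor x y := by
  rw [lor_comm, lor_smul_left, lor_comm]

theorem lor_origin (x : Mink n) : lor x (origin n) = x.1 := by simp [lor, origin]

theorem origin_mem_hypSpace : origin n ∈ hypSpace n := by simp [hypSpace, lor, origin]

theorem lor_rep_rep (b b' : Bdry n) : lor (rep b).1 (rep b').1 = 1 - ⟪b.1, b'.1⟫ := by
  simp [lor, rep]

theorem inv_apply_apply (g : hypIsom n) (x : Mink n) : (g⁻¹).1 (g.1 x) = x := g.1.symm_apply_apply x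

theorem apply_inv_apply (g : hypIsom n) (x : Mink n) : g.1 ((g⁻¹).1 x) = x := g.1.apply_symm_apply x

/-- The factor by which `g` stretches the isotropic vector `(1, b)`. -/
def stretch (g : hypIsom n) (b : Bdry n) : ℝ := (g.1 (rep b).1).1

/-- By invariance of `B`, `g` can be moved onto `o`. The stretch factor thus becomes an affine
function of `b` determined by `g⁻¹ o`, which gives its continuity, its positivity and the case of
the stabilizer. -/
theorem stretch_eq_lor (g : hypIsom n) (b : Bdry n) :
    stretch g b = lor (rep b).1 ((g⁻¹).1 (origin n)) := by
  rw [stretch, ← lor_origin, ← g.2.1 (rep b).1, apply_inv_apply]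

theorem apply_origin_mem (g : hypIsom n) : g.1 (origin n) ∈ hypSpace n := by
  rw [← g.2.2]
  exact mem_image_of_mem _ origin_mem_hypSpace

theorem continuous_stretch (g : hypIsom n) : Continuous (stretch g) := by
  have h : stretch g = fun b => ((g⁻¹).1 (origin n)).1 - ⟪b.1, ((g⁻¹).1 (origin n)).2⟫ := by
    funext b
    simp [stretch_eq_lor, lor, rep]
  rw [h]
  fun_prop

theorem stretch_pos (g : hypIsom n) (b : Bdry n) : 0 < stretch g b := by
  obtain ⟨h1, h2⟩ := apply_origin_mem g⁻¹
  rw [stretch_eq_lor]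
  set q := (g⁻¹).1 (origin n)
  -- A point `q` of the hyperboloid has `‖q.2‖ < q.1`, so Cauchy–Schwarz makes its pairing with `(1,
  -- b)` positive.
  have h3 : ⟪b.1, q.2⟫ ≤ ‖q.2‖ := by
    have := real_inner_le_norm b.1 q.2
    rwa [mem_sphere_zero_iff_norm.1 b.2, one_mul] at this
  rw [lor, real_inner_self_eq_norm_sq] at h1
  have h4 : ‖q.2‖ < q.1 := by
    refine lt_of_pow_lt_pow_left₀ 2 h2.le ?_
    nlinarith
  simp only [lor, rep, one_mul]
  linarith

theorem apply_rep (g : hypIsom n) (b : Bdry n) :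
    g.1 (rep b).1 = stretch g b • (rep (bdryAct g b)).1 := by
  have h := (stretch_pos g b).ne'
  refine Prod.ext ?_ ?_
  · simp [rep, stretch]
  · change _ = stretch g b • ((stretch g b)⁻¹ • (g.1 (rep b).1).2)
    rw [smul_inv_smul₀ h]

theorem smul_rep_injective {c c' : ℝ} {b b' : Bdry n} (hc : c ≠ 0)
    (h : c • (rep b).1 = c' • (rep b').1) : c = c' ∧ b = b' := by
  have h1 : c = c' := by simpa [rep] using congrArg Prod.fst h
  subst h1
  refine ⟨rfl, Subtype.ext ?_⟩
  have h2 := congrArg Prod.snd h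
  exact smul_right_injective _ hc h2

/-- Cocycle identity: apply `g⁻¹ g = 1` to `(1, b)` and compare multiples of normalized isotropic
vectors. -/
theorem stretch_mul_stretch_inv (g : hypIsom n) (b : Bdry n) :
    stretch g b * stretch g⁻¹ (bdryAct g b) = 1 ∧ bdryAct g⁻¹ (bdryAct g b) = b := by
  have h : (g⁻¹).1 (g.1 (rep b).1) = (1 : ℝ) • (rep b).1 := by rw [inv_apply_apply, one_smul]
  rw [apply_rep, map_smul, apply_rep, smul_smul] at h
  exact smul_rep_injective (mul_pos (stretch_pos _ _) (stretch_pos _ _)).ne' h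

theorem stretch_inv (g : hypIsom n) (b : Bdry n) :
    stretch g⁻¹ (bdryAct g b) = (stretch g b)⁻¹ :=
  eq_inv_of_mul_eq_one_right (stretch_mul_stretch_inv g b).1

theorem bdryAct_inv_bdryAct (g : hypIsom n) (b : Bdry n) : bdryAct g⁻¹ (bdryAct g b) = b :=
  (stretch_mul_stretch_inv g b).2

theorem bdryAct_bdryAct_inv (g : hypIsom n) (b : Bdry n) : bdryAct g (bdryAct g⁻¹ b) = b := by
  simpa using bdryAct_inv_bdryAct g⁻¹ b

/-- The left side is the Lorentz pairing of `(1, gb)` and `(1, gb')`, which are rescaled images of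
`(1, b)` and `(1, b')`. This is the source of the covariance of the kernel. -/
theorem one_sub_inner_bdryAct (g : hypIsom n) (b b' : Bdry n) :
    1 - ⟪(bdryAct g b).1, (bdryAct g b').1⟫ =
      (stretch g b)⁻¹ * (stretch g b')⁻¹ * (1 - ⟪b.1, b'.1⟫) := by
  have h := g.2.1 (rep b).1 (rep b').1
  rw [apply_rep, apply_rep, lor_smul_left, lor_smul_right, lor_rep_rep, lor_rep_rep] at h
  have := stretch_pos g b
  have := stretch_pos g b'
  rw [← h]
  field_simp

theorem continuous_bdryAct (g : hypIsom n) : Continuous (bdryAct g) := by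
  refine Continuous.subtype_mk ?_ _
  have h : Continuous fun b : Bdry n => g.1 (rep b).1 :=
    (LinearMap.continuous_of_finiteDimensional g.1.toLinearMap).comp
      (continuous_const.prodMk continuous_subtype_val)
  exact ((continuous_stretch g).inv₀ fun b => (stretch_pos g b).ne').smul
    (continuous_snd.comp h)

/-- The action of an isometry on the boundary, as an isomorphism of measurable spaces. -/
def bdryEquiv (g : hypIsom n) : Bdry n ≃ᵐ Bdry n where
  toFun := bdryAct g
  invFun := bdryAct g⁻¹
  left_inv := bdryAct_inv_bdryAct g
  right_inv := bdryAct_bdryAct_inv g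
  measurable_toFun := (continuous_bdryAct g).measurable
  measurable_invFun := (continuous_bdryAct g⁻¹).measurable

/-! ### The action in horospherical coordinates. -/

/-- The orthogonal projection onto the hyperplane orthogonal to `b`. -/
def perpProj (b : Bdry n) : Euc n →ₗ[ℝ] (ℝ ∙ (b : Euc n))ᗮ :=
  ((ℝ ∙ (b : Euc n))ᗮ.orthogonalProjectionOnto).toLinearMap

theorem coe_perpProj (b : Bdry n) (x : Euc n) :
    ((perpProj b x : (ℝ ∙ (b : Euc n))ᗮ) : Euc n) = x - ⟪b.1, x⟫ • b.1 := by
  have hb : ‖b.1‖ = 1 := mem_sphere_zero_iff_norm.1 b.2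
  rw [← Submodule.starProjection_unit_singleton ℝ hb]
  exact Submodule.starProjection_orthogonal_val x

theorem norm_perpProj_sq (b : Bdry n) (x : Euc n) :
    ‖perpProj b x‖ ^ 2 = ‖x‖ ^ 2 - ⟪b.1, x⟫ ^ 2 := by
  have hb : ‖b.1‖ = 1 := mem_sphere_zero_iff_norm.1 b.2
  rw [show ‖perpProj b x‖ = ‖((perpProj b x : (ℝ ∙ (b : Euc n))ᗮ) : Euc n)‖ from rfl, coe_perpProj, norm_sub_sq_real, norm_smul, hb, inner_smul_right,
    real_inner_comm, mul_one, Real.norm_eq_abs, sq_abs]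
  ring

theorem perpProj_self (b : Bdry n) : perpProj b b.1 = 0 := by
  have hb : ⟪b.1, b.1⟫ = 1 := by
    rw [real_inner_self_eq_norm_sq, mem_sphere_zero_iff_norm.1 b.2, one_pow]
  ext1
  rw [coe_perpProj, hb, one_smul, sub_self, Submodule.coe_zero]

/-- Fixing the pairing with `(1, b)` expresses `x.1` through `⟨b, x.2⟩`. The isotropy equation then
becomes linear in `⟨b, x.2⟩`, so the component orthogonal to `b` determines `x`. With
`lor_horo_rep`, the horospherical chart is exactly this slice of the cone. -/
theorem eq_horo (b : Bdry n) {x : Mink n} (h0 : lor x x = 0) (h1 : lor x (rep b).1 = √2) :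
    x = (horo b (perpProj b x.2)).1 := by
  have h2 : √2 ^ 2 = 2 := Real.sq_sqrt zero_le_two
  have h2' : √2 ≠ 0 := by positivity
  have h3 : ‖perpProj b x.2‖ ^ 2 / 2 = 1 + √2 * ⟪b.1, x.2⟫ := by
    rw [norm_perpProj_sq]
    simp only [lor, rep, mul_one, real_inner_self_eq_norm_sq, real_inner_comm] at h0 h1
    have : x.1 = √2 + ⟪b.1, x.2⟫ := by linarith
    rw [this] at h0
    nlinarith
  refine Prod.ext ?_ ?_
  · have h4 := horo_fst b (perpProj b x.2)
    rw [h3] at h4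
    refine mul_left_cancel₀ h2' ?_
    rw [h4]
    simp only [lor, rep, mul_one, real_inner_comm] at h1
    have : x.1 = √2 + ⟪b.1, x.2⟫ := by linarith
    rw [this]
    nlinarith
  · rw [horo_snd, h3, coe_perpProj, add_sub_cancel_left, mul_div_cancel_left₀ _ h2']
    abel

theorem lor_horo_rep (b : Bdry n) (v : (ℝ ∙ (b : Euc n))ᗮ) :
    lor (horo b v).1 (rep b).1 = √2 := by
  have hb : ⟪b.1, b.1⟫ = 1 := by
    rw [real_inner_self_eq_norm_sq, mem_sphere_zero_iff_norm.1 b.2, one_pow]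
  have hv : ⟪v.1, b.1⟫ = 0 := by
    rw [real_inner_comm]; exact (Submodule.mem_orthogonal_singleton_iff_inner_right).1 v.2
  have h2 : √2 ^ 2 = 2 := Real.sq_sqrt zero_le_two
  have h3 := horo_fst b v
  have h4 : √2 ≠ 0 := by positivity
  rw [lor, horo_snd, inner_add_left, real_inner_smul_left]
  simp only [rep, hb, hv, mul_one, add_zero]
  refine mul_left_cancel₀ h4 ?_
  rw [mul_sub, h3]
  field_simp
  linarith

/-- The linear isometry which `g` induces from `b^⊥` to `(g b)^⊥`. -/
def perpIsom (g : hypIsom n) (b : Bdry n) :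
    (ℝ ∙ (b : Euc n))ᗮ →ₗᵢ[ℝ] (ℝ ∙ (bdryAct g b : Euc n))ᗮ where
  toLinearMap := perpProj (bdryAct g b) ∘ₗ LinearMap.snd ℝ ℝ (Euc n) ∘ₗ g.1.toLinearMap ∘ₗ
    LinearMap.inr ℝ ℝ (Euc n) ∘ₗ (ℝ ∙ (b : Euc n))ᗮ.subtype
  norm_map' v := by
    have hv : ⟪v.1, b.1⟫ = 0 := by
      rw [real_inner_comm]; exact (Submodule.mem_orthogonal_singleton_iff_inner_right).1 v.2
    -- The image of `v` is orthogonal to `(1, gb)`, so its component along `gb` equals its time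
    -- coordinate. The squared norm left after projecting is minus its Lorentz square, which is
    -- `‖v‖²`.
    have h1 : lor (g.1 (0, v.1)) (rep (bdryAct g b)).1 = 0 := by
      have := g.2.1 (0, v.1) (rep b).1
      rw [apply_rep, lor_smul_right] at this
      simp only [lor, rep, hv, zero_mul, sub_zero] at this ⊢
      exact (mul_eq_zero.1 this).resolve_left (stretch_pos g b).ne'
    have h2 := g.2.1 (0, v.1) (0, v.1)
    refine (sq_eq_sq₀ (norm_nonneg _) (norm_nonneg _)).1 ?_
    change ‖perpProj (bdryAct g b) (g.1 (0, v.1)).2‖ ^ 2 = _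
    rw [norm_perpProj_sq]
    simp only [lor, rep, mul_one, real_inner_self_eq_norm_sq, mul_zero] at h1 h2
    rw [real_inner_comm] at h1
    rw [show ‖v‖ = ‖v.1‖ from rfl]
    have h3 : ⟪(bdryAct g b).1, (g.1 (0, v.1)).2⟫ = (g.1 (0, v.1)).1 := by linarith
    rw [h3]
    linarith

theorem perpIsom_apply (g : hypIsom n) (b : Bdry n) (v : (ℝ ∙ (b : Euc n))ᗮ) :
    perpIsom g b v = perpProj (bdryAct g b) (g.1 (0, v.1)).2 := rfl

/-- The similarity by which `g` acts in horospherical coordinates. -/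
def perpSim (g : hypIsom n) (b : Bdry n) (v : (ℝ ∙ (b : Euc n))ᗮ) :
    (ℝ ∙ (bdryAct g b : Euc n))ᗮ :=
  stretch g b • perpIsom g b v +
    perpProj (bdryAct g b) (stretch g b • g.1 ((1 / √2) • ((1, -b.1) : Mink n))).2

/-- Rescaling by `stretch g b` restores the pairing `√2` with `(1, gb)`, so `g` carries the slice at
`b` to the slice at `gb`, where `eq_horo` applies. -/
theorem stretch_smul_apply_horo (g : hypIsom n) (b : Bdry n) (v : (ℝ ∙ (b : Euc n))ᗮ) :
    stretch g b • g.1 (horo b v).1 = (horo (bdryAct g b) (perpSim g b v)).1 := by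
  have h1 : stretch g b • g.1 (horo b v).1 = (horo (bdryAct g b)
      (perpProj (bdryAct g b) (stretch g b • g.1 (horo b v).1).2)).1 := by
    refine eq_horo _ ?_ ?_
    · rw [lor_smul_left, lor_smul_right, g.2.1, (horo b v).2.1, mul_zero, mul_zero]
    · rw [lor_smul_left, ← lor_smul_right, ← apply_rep, g.2.1, lor_horo_rep]
  rw [h1]
  congr 2
  have h2 : (horo b v).1 = ((‖v‖ ^ 2 / 2) * (1 / √2)) • (rep b).1 +
      (1 / √2) • ((1, -b.1) : Mink n) + ((0, v.1) : Mink n) := by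
    rw [mul_smul]; rfl
  rw [h2, map_add, map_add, map_smul _ _ (rep b).1, apply_rep, perpSim, perpIsom_apply]
  simp only [smul_add, Prod.snd_add, map_add, Prod.smul_snd, map_smul]
  -- The only term quadratic in `v` is along `(1, b)`. Its image is along `(1, gb)` and projects to
  -- zero, which leaves an affine map.
  have h3 : perpProj (bdryAct g b) (rep (bdryAct g b)).1.2 = 0 := perpProj_self _
  rw [h3]
  simp only [smul_zero, zero_add]
  abel

theorem horo_eq_smul_rep (b : Bdry n) (v : (ℝ ∙ (b : Euc n))ᗮ) :
    (horo b v).1 = ((1 + ‖v‖ ^ 2 / 2) / √2) • (rep (horo b v).dir).1 := by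
  have h1 : (horo b v).1.1 = (1 + ‖v‖ ^ 2 / 2) / √2 := by
    rw [← horo_fst b v, mul_div_cancel_left₀ _ (by positivity)]
  refine Prod.ext ?_ ?_
  · simp [h1, rep]
  · conv_lhs => rw [norm_smul_dir, horo_snd_norm]
    rfl

/-- Both sides of `stretch_smul_apply_horo` are multiples of normalized isotropic vectors; compare
the factors and the directions. -/
theorem horo_perpSim (g : hypIsom n) (b : Bdry n) (v : (ℝ ∙ (b : Euc n))ᗮ) :
    1 + ‖perpSim g b v‖ ^ 2 / 2 =
        stretch g b * (stretch g (horo b v).dir * (1 + ‖v‖ ^ 2 / 2)) ∧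
      (horo (bdryAct g b) (perpSim g b v)).dir = bdryAct g (horo b v).dir := by
  have h := stretch_smul_apply_horo g b v
  rw [horo_eq_smul_rep b v, map_smul, apply_rep, horo_eq_smul_rep (bdryAct g b),
    smul_smul, smul_smul] at h
  obtain ⟨h1, h2⟩ := smul_rep_injective (by
    have := stretch_pos g b
    have := stretch_pos g (horo b v).dir
    positivity) h.symm
  refine ⟨?_, h2⟩
  have h4 : √2 ≠ 0 := by positivity
  field_simp at h1
  linarith

/-! ### The conformal change of variables and the Jacobian. -/

theorem lintegral_perpSim (hn : 2 ≤ n) (g : hypIsom n) (b : Bdry n)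
    {G : (ℝ ∙ (bdryAct g b : Euc n))ᗮ → ℝ≥0∞} (hG : Measurable G) :
    ∫⁻ w, G w = ENNReal.ofReal (stretch g b ^ (n - 1)) * ∫⁻ v, G (perpSim g b v) := by
  have hf1 := finrank_perp (by omega) b
  have hf2 := finrank_perp (by omega) (bdryAct g b)
  set c := perpProj (bdryAct g b) (stretch g b • g.1 ((1 / √2) • ((1, -b.1) : Mink n))).2 with hc
  rw [← lintegral_add_right_eq_self G c, lintegral_scale _ (by fun_prop) (stretch_pos g b), hf2]
  congr 1
  -- After removing the translation and the dilation, what remains is a linear isometry, onto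
  -- because both hyperplanes have dimension `n - 1`.
  have h := ((perpIsom g b).toLinearIsometryEquiv (hf1.trans hf2.symm)).measurePreserving
  rw [← h.lintegral_comp (by fun_prop)]
  rfl

theorem lintegral_toSphere (hn : 2 ≤ n) (b : Bdry n) {F : Bdry n → ℝ≥0∞} (hF : Measurable F) :
    ∫⁻ x, F x ∂(volume : Measure (Euc n)).toSphere = ENNReal.ofReal (√2 ^ (n - 1)) *
      ∫⁻ v, ENNReal.ofReal (dens b v) * F (horo b v).dir := by
  have hD : Measurable fun v => (horo b v).dir := (continuous_horo_dir b).measurable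
  rw [toSphere_eq_map hn b, lintegral_smul_measure, smul_eq_mul, lintegral_map hF hD]
  exact congrArg _ (lintegral_withDensity_eq_lintegral_mul _ (measurable_dens b).ennreal_ofReal
    (hF.comp hD))

theorem nonempty_bdry (hn : 2 ≤ n) : Nonempty (Bdry n) := by
  have : Nonempty (Fin n) := ⟨⟨0, by omega⟩⟩
  exact (NormedSpace.sphere_nonempty.2 zero_le_one).to_subtype

/-- The conformal density of an isometry. -/
def confDens (g : hypIsom n) (b : Bdry n) : ℝ := ((stretch g b) ^ (n - 1))⁻¹

theorem confDens_pos (g : hypIsom n) (b : Bdry n) : 0 < confDens g b := by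
  have := stretch_pos g b
  unfold confDens
  positivity

theorem continuous_confDens (g : hypIsom n) : Continuous (confDens g) :=
  ((continuous_stretch g).pow _).inv₀ fun b => pow_ne_zero _ (stretch_pos g b).ne'

/-- With charts centred at `gb` and at `b`, the action is a similarity of ratio `stretch g b`. Its
Jacobian cancels the same power in the transformed density, leaving only the stretch at the variable
point. -/
theorem lintegral_toSphere_bdryAct (hn : 2 ≤ n) (g : hypIsom n) {F : Bdry n → ℝ≥0∞}
    (hF : Measurable F) :
    ∫⁻ x, F x ∂(volume : Measure (Euc n)).toSphere =
      ∫⁻ x, ENNReal.ofReal (confDens g x) * F (bdryAct g x)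
        ∂(volume : Measure (Euc n)).toSphere := by
  obtain ⟨b⟩ := nonempty_bdry hn
  have hA := (continuous_bdryAct g).measurable
  have hD := (continuous_horo_dir (bdryAct g b)).measurable
  have hd := measurable_dens (bdryAct g b)
  have hc := (continuous_confDens g).measurable
  rw [lintegral_toSphere hn (bdryAct g b) hF, lintegral_toSphere hn b (by fun_prop),
    lintegral_perpSim hn g b (by fun_prop), ← lintegral_const_mul' _ _ ENNReal.ofReal_ne_top]
  congr 1
  refine lintegral_congr fun v => ?_
  obtain ⟨h1, h2⟩ := horo_perpSim g b v
  have hp := stretch_pos g b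
  have hq := stretch_pos g (horo b v).dir
  rw [h2, ← mul_assoc, ← mul_assoc, ← ENNReal.ofReal_mul (by positivity),
    ← ENNReal.ofReal_mul (dens_pos b v).le, dens, dens, h1, confDens, mul_pow, mul_pow]
  congr 2
  field_simp

theorem lintegral_bvol_bdryAct (hn : 2 ≤ n) (g : hypIsom n) {F : Bdry n → ℝ≥0∞}
    (hF : Measurable F) :
    ∫⁻ x, F x ∂(bvol n) = ∫⁻ x, ENNReal.ofReal (confDens g x) * F (bdryAct g x) ∂(bvol n) := by
  rw [bvol, lintegral_smul_measure, lintegral_smul_measure, lintegral_toSphere_bdryAct hn g hF]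

/-- The conformal change of variables on `∂Hⁿ`. -/
theorem map_bdryAct_inv (hn : 2 ≤ n) (g : hypIsom n) :
    (bvol n).map (bdryAct g⁻¹) =
      (bvol n).withDensity fun b => ENNReal.ofReal (confDens g b) := by
  have hA := (continuous_bdryAct g⁻¹).measurable
  ext A hA'
  rw [Measure.map_apply hA hA', withDensity_apply _ hA', ← lintegral_indicator_one (hA hA'),
    lintegral_bvol_bdryAct hn g (measurable_one.indicator (hA hA')), ← lintegral_indicator hA']
  refine lintegral_congr fun b => ?_
  have h : bdryAct g b ∈ bdryAct g⁻¹ ⁻¹' A ↔ b ∈ A := by rw [mem_preimage, bdryAct_inv_bdryAct]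
  by_cases hb : b ∈ A <;> simp [indicator, hb, bdryAct_inv_bdryAct]

/-- A Radon–Nikodym derivative is determined only almost everywhere; `confDens` is a continuous
representative. -/
theorem jac_ae_eq (hn : 2 ≤ n) (g : hypIsom n) : jac g =ᵐ[bvol n] confDens g := by
  have h := Measure.rnDeriv_withDensity (bvol n) (continuous_confDens g).measurable.ennreal_ofReal
  rw [← map_bdryAct_inv hn g] at h
  filter_upwards [h] with b hb
  rw [jac, hb, ENNReal.toReal_ofReal (confDens_pos g b).le]

theorem integral_bdryAct (hn : 2 ≤ n) (g : hypIsom n) (F : Bdry n → ℝ) :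
    ∫ b, F b ∂(bvol n) = ∫ b, confDens g b * F (bdryAct g b) ∂(bvol n) := by
  have h1 : ∫ b, F b ∂(bvol n) = ∫ b, F (bdryAct g b) ∂((bvol n).map (bdryAct g⁻¹)) := by
    have := (bdryEquiv g).symm.measurableEmbedding.integral_map (μ := bvol n)
      (fun b => F (bdryAct g b))
    change ∫ b, F (bdryAct g b) ∂((bvol n).map (bdryAct g⁻¹)) =
      ∫ b, F (bdryAct g (bdryAct g⁻¹ b)) ∂(bvol n) at this
    simp_rw [this, bdryAct_bdryAct_inv]
  rw [h1, map_bdryAct_inv hn g, integral_withDensity_eq_integral_toReal_smul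
    (continuous_confDens g).measurable.ennreal_ofReal
    (Filter.Eventually.of_forall fun _ => ENNReal.ofReal_lt_top)]
  refine integral_congr_ae (Filter.Eventually.of_forall fun b => ?_)
  simp only [ENNReal.toReal_ofReal (confDens_pos g b).le, smul_eq_mul]

end Conformal

/-! ### The normalization of the intertwining operator. -/

section Normalization

variable {n : ℕ}

theorem toSphere_univ_ne_zero (hn : 2 ≤ n) : (volume : Measure (Euc n)).toSphere univ ≠ 0 := by
  have : Nonempty (Fin n) := ⟨⟨0, by omega⟩⟩
  rw [Ne, Measure.measure_univ_eq_zero]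
  exact Measure.toSphere_ne_zero _

theorem isOpenPosMeasure_bvol (n : ℕ) : (bvol n).IsOpenPosMeasure := by
  rw [bvol]
  exact Measure.isOpenPosMeasure_smul _ (ENNReal.inv_ne_zero.2 (measure_ne_top _ _))

theorem kernelConst_pos (hn : 2 ≤ n) : 0 < kernelConst n :=
  mul_pos (ENNReal.toReal_pos (toSphere_univ_ne_zero hn) (measure_ne_top _ _)) (by positivity)

theorem memLp_of_continuous {f : Bdry n → ℝ} (hf : Continuous f) (p : ℝ≥0∞) :
    MemLp f p (bvol n) := by
  obtain ⟨C, hC⟩ := isCompact_univ.exists_bound_of_continuousOn hf.continuousOn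
  exact MemLp.of_bound hf.aestronglyMeasurable C
    (Filter.Eventually.of_forall fun x => hC x (mem_univ x))

theorem integrable_of_continuous {f : Bdry n → ℝ} (hf : Continuous f) :
    Integrable f (bvol n) :=
  memLp_one_iff_integrable.1 (memLp_of_continuous hf 1)

/-- The integral kernel of the intertwining operator. -/
def chordKernel (t : ℝ) (b b' : Bdry n) : ℝ := ((1 - ⟪b.1, b'.1⟫) / 2) ^ t

theorem half_one_sub_inner_nonneg (b b' : Bdry n) : 0 ≤ (1 - ⟪b.1, b'.1⟫) / 2 := by
  have := (le_abs_self _).trans (abs_inner_le (b, b'))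
  simp only at this
  linarith

theorem half_one_sub_inner_le_one (b b' : Bdry n) : (1 - ⟪b.1, b'.1⟫) / 2 ≤ 1 := by
  have := (neg_le_abs _).trans (abs_inner_le (b, b'))
  simp only at this
  linarith

theorem continuous_chordKernel {t : ℝ} (ht : 0 ≤ t) (b : Bdry n) :
    Continuous (chordKernel t b) := by
  unfold chordKernel
  exact Continuous.rpow_const (by fun_prop) fun _ => Or.inr ht

theorem chordKernel_bdryAct (t : ℝ) (g : hypIsom n) (b b' : Bdry n) :
    chordKernel t (bdryAct g b) (bdryAct g b') =
      (stretch g b ^ t)⁻¹ * (stretch g b' ^ t)⁻¹ * chordKernel t b b' := by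
  have h1 := (stretch_pos g b).le
  have h2 := (stretch_pos g b').le
  rw [chordKernel, one_sub_inner_bdryAct, mul_div_assoc,
    Real.mul_rpow (by positivity) (half_one_sub_inner_nonneg b b'),
    Real.mul_rpow (by positivity) (by positivity), Real.inv_rpow h1, Real.inv_rpow h2, chordKernel]

/-- For the constant function the integrand depends only on `‖v‖`, and the hyperplanes `b^⊥` are all
isometric. -/
theorem intertwineRaw_one_eq (hn : 2 ≤ n) (s : ℝ) (b b' : Bdry n) :
    intertwineRaw s (fun _ => 1) b = intertwineRaw s (fun _ => 1) b' := by
  have h1 := finrank_perp (by omega) b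
  have h2 := finrank_perp (by omega) b'
  let e : (ℝ ∙ (b : Euc n))ᗮ ≃ₗᵢ[ℝ] (ℝ ∙ (b' : Euc n))ᗮ :=
    (stdOrthonormalBasis ℝ _).equiv (stdOrthonormalBasis ℝ _) (finCongr (h1.trans h2.symm))
  rw [intertwineRaw, intertwineRaw,
    ← e.measurePreserving.integral_comp e.toHomeomorph.measurableEmbedding]
  simp only [coneExt, horo_fst, e.norm_map]

theorem intertwineRaw_one (hn : 2 ≤ n) (t : ℝ) (b : Bdry n) :
    intertwineRaw (sParam n t) (fun _ => 1) b =
      kernelConst n * ∫ b', chordKernel t b b' ∂(bvol n) := by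
  rw [intertwineRaw_eq hn t aestronglyMeasurable_const]
  simp only [mul_one, chordKernel]

/-- For `w = (1 - ⟨b, b'⟩)/2` in `[0, 1]` one has `w^t ≥ w`, and the values of `w` at `b` and `-b`
add up to 1. As the raw integral of 1 is the same at both points, this makes the normalizing
constant positive. -/
theorem integral_chordKernel_add_neg [n.AtLeastTwo] {t : ℝ} (ht : t ∈ Ioo (0 : ℝ) 1)
    (b : Bdry n) :
    1 ≤ (∫ b', chordKernel t b b' ∂(bvol n)) + ∫ b', chordKernel t (-b) b' ∂(bvol n) := by
  have := isProbabilityMeasure_bvol n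
  have h1 := integrable_of_continuous (continuous_chordKernel ht.1.le b)
  have h2 := integrable_of_continuous (continuous_chordKernel ht.1.le (-b))
  rw [← integral_add h1 h2]
  have h3 : ∫ _ : Bdry n, (1 : ℝ) ∂(bvol n) = 1 := by simp
  refine h3.symm.trans_le ?_
  refine integral_mono (integrable_const _) (h1.add h2) fun b' => ?_
  have key : ∀ x : Bdry n, (1 - ⟪x.1, b'.1⟫) / 2 ≤ chordKernel t x b' := fun x => by
    have := Real.rpow_le_rpow_of_exponent_ge' (half_one_sub_inner_nonneg x b')
      (half_one_sub_inner_le_one x b') ht.1.le ht.2.le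
    rwa [Real.rpow_one] at this
  have h4 := key b
  have h5 := key (-b)
  have h6 : ⟪(-b).1, b'.1⟫ = -⟪b.1, b'.1⟫ := inner_neg_left _ _
  rw [h6] at h5
  simp only
  linarith

theorem intertwineRaw_one_pos [n.AtLeastTwo] {t : ℝ} (ht : t ∈ Ioo (0 : ℝ) 1) (b : Bdry n) :
    0 < intertwineRaw (sParam n t) (fun _ => 1) b := by
  have hn : 2 ≤ n := Nat.AtLeastTwo.prop
  have hk := kernelConst_pos hn
  have h1 := integral_chordKernel_add_neg ht b
  have h2 := intertwineRaw_one_eq hn (sParam n t) b (-b)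
  rw [intertwineRaw_one hn, intertwineRaw_one hn] at h2
  rw [← mul_left_cancel₀ hk.ne' h2] at h1
  rw [intertwineRaw_one hn]
  exact mul_pos hk (by linarith)

/-- The normalization `L_s 1 = 1`. -/
theorem intertwine_one [n.AtLeastTwo] {t : ℝ} (ht : t ∈ Ioo (0 : ℝ) 1) (b : Bdry n) :
    intertwine (sParam n t) (fun _ => 1) b = 1 := by
  have := isProbabilityMeasure_bvol n
  have h : ∫ b', intertwineRaw (sParam n t) (fun _ => 1) b' ∂(bvol n) =
      intertwineRaw (sParam n t) (fun _ => 1) b := by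
    simp_rw [fun b' => intertwineRaw_one_eq Nat.AtLeastTwo.prop (sParam n t) b' b]
    simp
  rw [intertwine, h, inv_mul_cancel₀ (intertwineRaw_one_pos ht b).ne']

theorem intertwine_eq (hn : 2 ≤ n) (t : ℝ) {f : Bdry n → ℝ}
    (hf : AEStronglyMeasurable f (bvol n)) (b : Bdry n) :
    intertwine (sParam n t) f b =
      formConst n t * ∫ b', chordKernel t b b' * f b' ∂(bvol n) := by
  rw [intertwine, intertwineRaw_eq hn t hf, formConst, mul_assoc]
  rfl

theorem formConst_mul_integral [n.AtLeastTwo] {t : ℝ} (ht : t ∈ Ioo (0 : ℝ) 1) (b : Bdry n) :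
    formConst n t * ∫ b', chordKernel t b b' ∂(bvol n) = 1 := by
  have h := intertwine_one ht b
  rw [intertwine_eq Nat.AtLeastTwo.prop t aestronglyMeasurable_const] at h
  simpa only [mul_one] using h

theorem form_one_left [n.AtLeastTwo] {t : ℝ} (ht : t ∈ Ioo (0 : ℝ) 1) {f : Bdry n → ℝ}
    (hf : Integrable f (bvol n)) : form (sParam n t) (fun _ => 1) f = ∫ b, f b ∂(bvol n) := by
  have := isProbabilityMeasure_bvol n
  rw [form_symm Nat.AtLeastTwo.prop ht.1.le (integrable_const _) hf, form]
  simp_rw [intertwine_one ht, mul_one]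

/-- Allows the a.e. defined Jacobian power to be replaced by `orbitFun`. -/
theorem form_self_congr (hn : 2 ≤ n) (t : ℝ) {f h : Bdry n → ℝ} (hfh : f =ᵐ[bvol n] h)
    (hh : AEStronglyMeasurable h (bvol n)) :
    form (sParam n t) f f = form (sParam n t) h h := by
  refine integral_congr_ae ?_
  filter_upwards [hfh] with b hb
  rw [intertwine_eq hn t hh, intertwine_eq hn t (hh.congr hfh.symm), hb]
  congr 2
  refine integral_congr_ae ?_
  filter_upwards [hfh] with b' hb'
  rw [hb']

end Normalization

/-! ### The orbit point and its pairing with the base point. -/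

section Orbit

variable {n : ℕ}

/-- The continuous representative of the function `|Jac(g⁻¹)|^(1/2 + s)`. -/
def orbitFun (t : ℝ) (g : hypIsom n) (b : Bdry n) : ℝ := confDens g⁻¹ b ^ (1 / 2 + sParam n t)

theorem continuous_orbitFun (t : ℝ) (g : hypIsom n) : Continuous (orbitFun t g) :=
  (continuous_confDens g⁻¹).rpow_const fun b => Or.inl (confDens_pos g⁻¹ b).ne'

theorem prinSeries_one_ae_eq (hn : 2 ≤ n) (t : ℝ) (g : hypIsom n) :
    prinSeries (sParam n t) g (fun _ => 1) =ᵐ[bvol n] orbitFun t g := by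
  filter_upwards [jac_ae_eq hn g⁻¹] with b hb
  rw [prinSeries, hb, mul_one, orbitFun]

theorem memLp_prinSeries_one (hn : 2 ≤ n) (t : ℝ) (g : hypIsom n) :
    MemLp (prinSeries (sParam n t) g (fun _ => 1)) 2 (bvol n) :=
  (memLp_congr_ae (prinSeries_one_ae_eq hn t g)).2 (memLp_of_continuous (continuous_orbitFun t g) 2)

theorem confDens_mul_orbitFun (hn : 2 ≤ n) (t : ℝ) (g : hypIsom n) (b : Bdry n) :
    confDens g b * orbitFun t g (bdryAct g b) = stretch g b ^ t := by
  have h := stretch_pos g b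
  have h2 : (n : ℝ) - 1 ≠ 0 := by
    have : (2 : ℝ) ≤ n := by exact_mod_cast hn
    linarith
  have h3 : 1 / 2 + sParam n t = 1 + t / ((n : ℝ) - 1) := by rw [sParam]; ring
  have h4 : ((n - 1 : ℕ) : ℝ) = (n : ℝ) - 1 := by rw [Nat.cast_sub (by omega), Nat.cast_one]
  rw [orbitFun, confDens, confDens, stretch_inv, inv_pow, inv_inv, h3,
    Real.rpow_add (by positivity), Real.rpow_one, inv_mul_cancel_left₀ (by positivity),
    ← Real.rpow_natCast, h4, ← Real.rpow_mul h.le, mul_div_cancel₀ _ h2]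

theorem integral_orbitFun (hn : 2 ≤ n) (t : ℝ) (g : hypIsom n) :
    ∫ b, orbitFun t g b ∂(bvol n) = ∫ b, stretch g b ^ t ∂(bvol n) := by
  rw [integral_bdryAct hn g]
  simp_rw [confDens_mul_orbitFun hn]

theorem form_orbitFun [n.AtLeastTwo] {t : ℝ} (ht : t ∈ Ioo (0 : ℝ) 1) (g : hypIsom n) :
    form (sParam n t) (orbitFun t g) (orbitFun t g) = 1 := by
  have := isProbabilityMeasure_bvol n
  have hn : 2 ≤ n := Nat.AtLeastTwo.prop
  -- The intertwining property on the constant 1: the right side is `π_{-s}(g) 1` at `gb`. The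
  -- factors at `b'` from the kernel and from `orbitFun` cancel.
  have h1 : ∀ b, intertwine (sParam n t) (orbitFun t g) (bdryAct g b) = (stretch g b ^ t)⁻¹ := by
    intro b
    rw [intertwine_eq hn t (continuous_orbitFun t g).aestronglyMeasurable, integral_bdryAct hn g]
    have h2 : ∀ b', confDens g b' * (chordKernel t (bdryAct g b) (bdryAct g b') *
        orbitFun t g (bdryAct g b')) = (stretch g b ^ t)⁻¹ * chordKernel t b b' := by
      intro b'
      have h3 := confDens_mul_orbitFun hn t g b'
      have h4 : 0 < stretch g b' ^ t := Real.rpow_pos_of_pos (stretch_pos g b') t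
      rw [mul_left_comm, h3, chordKernel_bdryAct]
      field_simp
    simp_rw [h2]
    rw [integral_const_mul, mul_left_comm, formConst_mul_integral ht, mul_one]
  rw [form, integral_bdryAct hn g]
  have h5 : ∀ b, confDens g b * (orbitFun t g (bdryAct g b) *
      intertwine (sParam n t) (orbitFun t g) (bdryAct g b)) = 1 := by
    intro b
    rw [h1, ← mul_assoc, confDens_mul_orbitFun hn,
      mul_inv_cancel₀ (Real.rpow_pos_of_pos (stretch_pos g b) t).ne']
  simp_rw [h5]
  simp

theorem ofL2_fst [n.AtLeastTwo] (t : Ioo (0 : ℝ) 1) (f : Bdry n → ℝ) (hf : MemLp f 2 (bvol n)) :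
    (ofL2 t f hf).1 = ∫ b, f b ∂(bvol n) := rfl

/-- On `L²(∂Hⁿ)` the form of `H⁰ ⊕ V` is `⟨·, ·⟩_s`. -/
theorem ambForm_ofL2_self [n.AtLeastTwo] (t : Ioo (0 : ℝ) 1) (f : Bdry n → ℝ)
    (hf : MemLp f 2 (bvol n)) :
    ambForm (ofL2 t f hf) (ofL2 t f hf) = form (sParam n t) f f := by
  have := isProbabilityMeasure_bvol n
  have hn : 2 ≤ n := Nat.AtLeastTwo.prop
  have ht := t.2.1.le
  have hfi := hf.integrable one_le_two
  set c := ∫ b, f b ∂(bvol n) with hc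
  set f₀ : Bdry n → ℝ := fun b => f b - c with hf₀
  have h1 : Integrable (fun _ : Bdry n => (1 : ℝ)) (bvol n) := integrable_const _
  have hf₀i : Integrable f₀ (bvol n) := hfi.sub (integrable_const _)
  have hf₀c : ∫ b, f₀ b ∂(bvol n) = 0 := by
    simp only [hf₀]
    rw [integral_sub hfi (integrable_const _)]
    simp [hc]
  have hsplit : f = f₀ + c • fun _ : Bdry n => (1 : ℝ) := by
    funext b
    simp [hf₀]
  have hL : ∀ h : Bdry n → ℝ, Integrable h (bvol n) → form (sParam n t) f h =
      form (sParam n t) f₀ h + c * ∫ b, h b ∂(bvol n) := by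
    intro h hh
    conv_lhs => rw [hsplit]
    rw [form_add_left hn ht hf₀i (h1.smul c) hh, form_smul_left, form_one_left t.2 hh]
  rw [hL f hfi, form_symm hn ht hf₀i hfi, hL f₀ hf₀i, hf₀c, ambForm, mul_zero, add_zero, ofL2_fst,
    ← hc, add_comm, sub_eq_add_neg]
  congr 1
  -- The inner product of `V` is minus the form, so subtracting it in `ambForm` adds the form on the
  -- mean-zero part.
  rw [neg_eq_iff_eq_neg]
  exact UniformSpace.Completion.inner_coe _ _

theorem ambForm_basePoint [n.AtLeastTwo] (t : Ioo (0 : ℝ) 1) (x : Ambient n t) :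
    ambForm x (basePoint n t) = x.1 := by
  simp [ambForm, basePoint]

theorem ofL2_prinSeries_fst [n.AtLeastTwo] (t : Ioo (0 : ℝ) 1) (g : hypIsom n)
    (hL : MemLp (prinSeries (sParam n t) g (fun _ => 1)) 2 (bvol n)) :
    (ofL2 t _ hL).1 = ∫ b, stretch g b ^ (t : ℝ) ∂(bvol n) := by
  have hn : 2 ≤ n := Nat.AtLeastTwo.prop
  rw [ofL2_fst, integral_congr_ae (prinSeries_one_ae_eq hn t g), integral_orbitFun hn]

theorem continuous_stretch_rpow (t : ℝ) (g : hypIsom n) :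
    Continuous fun b => stretch g b ^ t :=
  (continuous_stretch g).rpow_const fun b => Or.inl (stretch_pos g b).ne'

theorem integral_stretch_rpow_pos [n.AtLeastTwo] (t : ℝ) (g : hypIsom n) :
    0 < ∫ b, stretch g b ^ t ∂(bvol n) := by
  have := isProbabilityMeasure_bvol n
  have h : ∀ b, 0 < stretch g b ^ t := fun b => Real.rpow_pos_of_pos (stretch_pos g b) t
  rw [integral_pos_iff_support_of_nonneg (fun b => (h b).le)
    (integrable_of_continuous (continuous_stretch_rpow t g)),
    Function.support_eq_univ fun b => (h b).ne', measure_univ]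
  exact one_pos

theorem ofL2_prinSeries_mem [n.AtLeastTwo] (t : Ioo (0 : ℝ) 1) (g : hypIsom n)
    (hL : MemLp (prinSeries (sParam n t) g (fun _ => 1)) 2 (bvol n)) :
    ofL2 t _ hL ∈ hypSpaceInf n t := by
  refine ⟨?_, ?_⟩
  · rw [ambForm_ofL2_self, form_self_congr Nat.AtLeastTwo.prop t
      (prinSeries_one_ae_eq Nat.AtLeastTwo.prop t g)
      (continuous_orbitFun _ g).aestronglyMeasurable, form_orbitFun t.2]
  · rw [ofL2_prinSeries_fst]
    exact integral_stretch_rpow_pos _ _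

theorem one_le_fst_of_mem [n.AtLeastTwo] (t : Ioo (0 : ℝ) 1) {x : Ambient n t}
    (hx : x ∈ hypSpaceInf n t) : 1 ≤ x.1 := by
  obtain ⟨h1, h2⟩ := hx
  have h3 : (0 : ℝ) ≤ ⟪x.2, x.2⟫ := real_inner_self_nonneg
  rw [ambForm] at h1
  nlinarith

theorem stretch_eq_one_iff (hn : 2 ≤ n) (g : hypIsom n) :
    (∀ b, stretch g b = 1) ↔ g ∈ orthoGroup n := by
  constructor
  · intro h
    obtain ⟨b⟩ := nonempty_bdry hn
    have h1 := h b
    have h2 := h (-b)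
    have h3 := (apply_origin_mem g⁻¹).1
    rw [stretch_eq_lor] at h1 h2
    set q := (g⁻¹).1 (origin n) with hq
    simp only [lor, rep, one_mul] at h1 h2
    have h6 : ⟪(-b).1, q.2⟫ = -⟪b.1, q.2⟫ := inner_neg_left _ _
    rw [h6] at h2
    -- Averaging the affine function over the antipodal pair `b`, `-b` leaves the time coordinate of
    -- `g⁻¹ o`; the hyperboloid equation then kills the rest.
    have h7 : q.1 = 1 := by linarith
    rw [lor, h7, real_inner_self_eq_norm_sq] at h3
    have h8 : q.2 = 0 := by
      rw [← norm_eq_zero]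
      refine pow_eq_zero_iff two_ne_zero |>.1 ?_
      linarith
    have h9 : q = origin n := Prod.ext h7 h8
    have h10 : g⁻¹ ∈ orthoGroup n := h9
    exact inv_mem_iff.1 h10
  · intro h b
    have h1 : (g⁻¹).1 (origin n) = origin n := inv_mem h
    rw [stretch_eq_lor, h1, lor_origin]
    rfl

end Orbit

/-! ### Bounds as the parameter tends to zero. -/

section Asymptotics

variable {n : ℕ}

theorem one_add_half_sq_le_cosh {x : ℝ} (hx : 0 ≤ x) : 1 + x ^ 2 / 2 ≤ Real.cosh x := by
  have h1 : Real.cosh x = 1 + 2 * Real.sinh (x / 2) ^ 2 := by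
    conv_lhs => rw [← mul_div_cancel₀ x (two_ne_zero (α := ℝ)), Real.cosh_two_mul, Real.cosh_sq]
    ring
  have h2 : x / 2 ≤ Real.sinh (x / 2) := Real.self_le_sinh_iff.2 (by linarith)
  rw [h1]
  nlinarith

/-- Bernoulli's inequality for exponents in `[0, 1]`, integrated. -/
theorem integral_stretch_rpow_le [n.AtLeastTwo] {t : ℝ} (ht : t ∈ Ioo (0 : ℝ) 1)
    (g : hypIsom n) :
    ∫ b, stretch g b ^ t ∂(bvol n) ≤ 1 + t * ∫ b, (stretch g b - 1) ∂(bvol n) := by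
  have := isProbabilityMeasure_bvol n
  have hi : Integrable (fun b => stretch g b - 1) (bvol n) :=
    integrable_of_continuous ((continuous_stretch g).sub continuous_const)
  have h : ∫ b, (1 + t * (stretch g b - 1)) ∂(bvol n) =
      1 + t * ∫ b, (stretch g b - 1) ∂(bvol n) := by
    rw [integral_add (integrable_const _) (hi.const_mul t), integral_const_mul]
    simp
  rw [← h]
  refine integral_mono (integrable_of_continuous (continuous_stretch_rpow t g))
    ((integrable_const _).add (hi.const_mul t)) fun b => ?_
  have h1 := stretch_pos g b
  have h2 := rpow_one_add_le_one_add_mul_self (by linarith : -1 ≤ stretch g b - 1) ht.1.le ht.2.le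
  rwa [add_sub_cancel] at h2

theorem continuous_log_stretch (g : hypIsom n) : Continuous fun b => Real.log (stretch g b) :=
  (continuous_stretch g).log fun b => (stretch_pos g b).ne'

/-- The inequality `1 + x ≤ exp x` at `x = t log λ`, integrated. -/
theorem le_integral_stretch_rpow [n.AtLeastTwo] (t : ℝ) (g : hypIsom n) :
    1 + t * ∫ b, Real.log (stretch g b) ∂(bvol n) ≤ ∫ b, stretch g b ^ t ∂(bvol n) := by
  have := isProbabilityMeasure_bvol n
  have hi := integrable_of_continuous (continuous_log_stretch g)
  have h : ∫ b, (1 + t * Real.log (stretch g b)) ∂(bvol n) =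
      1 + t * ∫ b, Real.log (stretch g b) ∂(bvol n) := by
    rw [integral_add (integrable_const _) (hi.const_mul t), integral_const_mul]
    simp
  rw [← h]
  refine integral_mono ((integrable_const _).add (hi.const_mul t))
    (integrable_of_continuous (continuous_stretch_rpow t g)) fun b => ?_
  simp only
  rw [Real.rpow_def_of_pos (stretch_pos g b), mul_comm (Real.log _), add_comm]
  exact Real.add_one_le_exp _

/-- Integrate `log x ≤ x - 1` at `x = confDens g b`, which has mean 1 and logarithm `-(n-1) log λ`.
By continuity and full support of the volume, strictness at one point suffices. -/
theorem integral_log_stretch_pos [n.AtLeastTwo] {g : hypIsom n} (hg : g ∉ orthoGroup n) :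
    0 < ∫ b, Real.log (stretch g b) ∂(bvol n) := by
  have := isProbabilityMeasure_bvol n
  have := isOpenPosMeasure_bvol n
  have hn : 2 ≤ n := Nat.AtLeastTwo.prop
  have hlog : ∀ b, Real.log (confDens g b) = -((n - 1 : ℕ) * Real.log (stretch g b)) := fun b => by
    rw [confDens, Real.log_inv, Real.log_pow]
  -- The change of variables applied to the constant 1.
  have hint : ∫ b, confDens g b ∂(bvol n) = 1 := by
    have := integral_bdryAct hn g fun _ => 1
    simp only [mul_one] at this
    rw [← this]
    simp
  have hd := continuous_confDens g
  have hl := continuous_log_stretch g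
  have hk : Continuous fun b => confDens g b - 1 - Real.log (confDens g b) := by
    simp_rw [hlog]
    fun_prop
  have hpos : 0 < ∫ b, (confDens g b - 1 - Real.log (confDens g b)) ∂(bvol n) := by
    rw [← stretch_eq_one_iff hn] at hg
    push Not at hg
    obtain ⟨b, hb⟩ := hg
    refine hk.integral_pos_of_hasCompactSupport_nonneg_nonzero (x := b)
      (HasCompactSupport.of_compactSpace _) (fun x => ?_) ?_
    · have := Real.log_le_sub_one_of_pos (confDens_pos g x)
      simp only [Pi.zero_apply]
      linarith
    · have h1 : confDens g b ≠ 1 := by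
        rw [confDens, Ne, inv_eq_one]
        exact fun h => hb ((pow_eq_one_iff_of_nonneg (stretch_pos g b).le (by omega)).1 h)
      have := Real.log_lt_sub_one_of_pos (confDens_pos g b) h1
      linarith
  have heq : ∫ b, (confDens g b - 1 - Real.log (confDens g b)) ∂(bvol n) =
      (n - 1 : ℕ) * ∫ b, Real.log (stretch g b) ∂(bvol n) := by
    simp_rw [hlog, sub_neg_eq_add]
    have h1 : Integrable (fun b => confDens g b - 1) (bvol n) :=
      (integrable_of_continuous hd).sub (integrable_const _)
    rw [integral_add h1
      ((integrable_of_continuous hl).const_mul _), integral_sub (integrable_of_continuous hd)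
      (integrable_const _), hint, integral_const_mul]
    simp
  rw [heq] at hpos
  exact pos_of_mul_pos_right hpos (Nat.cast_nonneg _)

end Asymptotics

end

end HypRenorm

theorem mainTheorem11 (n : ℕ) [n.AtLeastTwo] (g : hypIsom n) :
    ∃ hL : ∀ t : Ioo (0 : ℝ) 1, MemLp (prinSeries (sParam n t) g (fun _ => 1)) 2 (bvol n),
      (∀ t : Ioo (0 : ℝ) 1, ofL2 t _ (hL t) ∈ hypSpaceInf n t) ∧
      (∃ C : ℝ, ∃ δ : ℝ, 0 < δ ∧ ∀ t : Ioo (0 : ℝ) 1, (t : ℝ) < δ →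
        hypDist (ofL2 t _ (hL t)) (basePoint n t) / √(t : ℝ) ≤ C) ∧
      ((∃ c : ℝ, 0 < c ∧ ∃ δ : ℝ, 0 < δ ∧ ∀ t : Ioo (0 : ℝ) 1, (t : ℝ) < δ →
        c ≤ hypDist (ofL2 t _ (hL t)) (basePoint n t) / √(t : ℝ)) ↔ g ∉ orthoGroup n) := by
  have hn : 2 ≤ n := Nat.AtLeastTwo.prop
  have := isProbabilityMeasure_bvol n
  refine ⟨fun t => memLp_prinSeries_one hn t g, fun t => ofL2_prinSeries_mem t g _, ?_⟩
  have hdist : ∀ t : Ioo (0 : ℝ) 1,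
      hypDist (ofL2 t _ (memLp_prinSeries_one hn t g)) (basePoint n t) =
        Real.arcosh (∫ b, stretch g b ^ (t : ℝ) ∂(bvol n)) := fun t => by
    rw [hypDist, ambForm_basePoint, ofL2_prinSeries_fst]
  have hone : ∀ t : Ioo (0 : ℝ) 1, 1 ≤ ∫ b, stretch g b ^ (t : ℝ) ∂(bvol n) := fun t => by
    rw [← ofL2_prinSeries_fst t g (memLp_prinSeries_one hn t g)]
    exact one_le_fst_of_mem t (ofL2_prinSeries_mem t g _)
  simp_rw [hdist]
  -- The constant comes from `1 + d²/2 ≤ cosh d ≤ 1 + t ∫ (λ - 1)`, valid on all of `(0, 1)`; hence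
  -- `δ = 1`.
  refine ⟨⟨√(2 * ∫ b, (stretch g b - 1) ∂(bvol n)), 1, one_pos, fun t _ => ?_⟩, ?_, ?_⟩
  · have h1 := integral_stretch_rpow_le t.2 g
    have h2 := one_add_half_sq_le_cosh (Real.arcosh_nonneg (hone t))
    rw [Real.cosh_arcosh (hone t)] at h2
    rw [div_le_iff₀ (Real.sqrt_pos.2 t.2.1), ← Real.sqrt_mul' _ t.2.1.le]
    refine Real.le_sqrt_of_sq_le ?_
    linarith
  · rintro ⟨c, hc, δ, hδ, h⟩ hg
    obtain ⟨t, ht0, ht⟩ := exists_between (lt_min hδ one_pos)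
    have h1 := h ⟨t, ht0, ht.trans_le (min_le_right _ _)⟩ (ht.trans_le (min_le_left _ _))
    -- For `g` in `O(n)` the distance vanishes, so a single admissible `t` contradicts `0 < c`.
    simp only [(stretch_eq_one_iff hn g).2 hg, Real.one_rpow, integral_const, probReal_univ,
      smul_eq_mul, mul_one, Real.arcosh_zero, zero_div] at h1
    linarith
  · intro hg
    have hK := integral_log_stretch_pos hg
    set K := ∫ b, Real.log (stretch g b) ∂(bvol n)
    -- From `1 + tK ≤ cosh d ≤ exp(d²/2)` one gets `d²/2 ≥ log(1 + tK) ≥ tK/(1 + tK) ≥ tK/(1 + K)`,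
    -- the last step by `t < 1`.
    refine ⟨√(2 * K / (1 + K)), Real.sqrt_pos.2 (by positivity), 1, one_pos, fun t _ => ?_⟩
    have ht0 : (0 : ℝ) < t := t.2.1
    have ht1 : (t : ℝ) < 1 := t.2.2
    have h1 := le_integral_stretch_rpow t g
    have h2 := Real.cosh_le_exp_half_sq (Real.arcosh (∫ b, stretch g b ^ (t : ℝ) ∂(bvol n)))
    rw [Real.cosh_arcosh (hone t)] at h2
    have hp : 0 < 1 + t * K := by positivity
    have h3 := (Real.log_le_iff_le_exp hp).2 (h1.trans h2)
    have h4 := Real.one_sub_inv_le_log_of_pos hp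
    have h5 : t * K / (1 + K) ≤ 1 - (1 + t * K)⁻¹ := by
      have h6 : 1 - (1 + t * K)⁻¹ = t * K / (1 + t * K) := by field_simp; ring
      rw [h6]
      gcongr
      nlinarith
    rw [le_div_iff₀ (Real.sqrt_pos.2 ht0), ← Real.sqrt_mul' _ ht0.le]
    refine Real.sqrt_le_iff.2 ⟨Real.arcosh_nonneg (hone t), ?_⟩
    have h7 : 2 * K / (1 + K) * t = 2 * (t * K / (1 + K)) := by ring
    rw [h7]
    linarith
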